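/- For a positive integer $d$, let $Q_d$ be the $d$-dimensional hypercube. The distance between two edges $e,e'$ is the number of edges in a shortest path between an endpoint of $e$ and an endpoint of $e'$, and the $27$-neighborhood of an edge $e$ is the subgraph of $Q_d$ formed by all edges at distance at most $27$ from $e$. A dimensional matching of $Q_d$ is a perfect matching $M$ such that $Q_d-M$ is isomorphic to two disjoint copies of $Q_{d-1}$. A $d$-edge precoloring $\varphi$ of $Q_d$ is a proper partial edge coloring of $Q_d$ with colors $1,\dots,d$. It is $\alpha$-dense if (i) at most $\alpha d$ edges are precolored at each vertex; (ii) in every $27$-neighborhood of an edge, and for every color $i\in\{1,\dots,d\}$, at most $\alpha d$ edges are precolored with $i$; (iii) for every $27$-neighborhood $W$ of an edge and every dimensional matching $M$, at most $\alpha d$ edges of $M$ contained in $W$ are precolored. A list assignment $L$ for $E(Q_d)$, $L(e)\subseteq\{1,\dots,d\}$, is $\beta$-sparse if (i) $|L(e)|\le\beta d$ for every edge $e$; (ii) for every vertex $v$, each color occurs in at most $\beta d$ of the lists of edges incident to $v$; (iii) for every $27$-neighborhood $W$ of an edge and every dimensional matching $M$, each color occurs in at most $\beta d$ of the lists of edges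 of $M$ contained in $W$. Theorem. There are constants $\alpha>0$ and $\beta>0$ such that, for every positive integer $d$, the following holds. If $\varphi$ is an $\alpha$-dense $d$-edge precoloring of $Q_d$, $L$ is a $\beta$-sparse list assignment for $Q_d$, and $\varphi(e)\notin L(e)$ for every precolored edge $e$, then there is a proper $d$-edge coloring $f$ of $Q_d$ with $f(e)=\varphi(e)$ for every precolored edge $e$ and $f(e)\notin L(e)$ for every edge $e$ of $Q_d$. -/

import Mathlib

/-- The `d`-dimensional hypercube `Q_d`: the vertices are the binary strings of length `d`,
two of them being adjacent when they differ in exactly one coordinate. -/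
def hypercube (d : ℕ) : SimpleGraph (Fin d → Bool) where
  Adj x y := hammingDist x y = 1
  symm := ⟨fun x y h => by rw [hammingDist_comm]; exact h⟩
  loopless := ⟨fun x h => by simp at h⟩

/-- The edge set of the `t`-neighborhood of the edge `e` of `G`: all edges `f` such that some
endpoint of `e` and some endpoint of `f` are joined by a path with at most `t` edges. -/
def edgeNeighborhood {V : Type*} (G : SimpleGraph V) (t : ℕ) (e : G.edgeSet) : Set G.edgeSet :=
  {f | ∃ u ∈ (e : Sym2 V), ∃ v ∈ (f : Sym2 V), G.edist u v ≤ t}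

/-- A dimensional matching of `Q_d` (`d ≥ 1`): a perfect matching `M` such that `Q_d - M` is
isomorphic to two disjoint copies of `Q_{d-1}`. -/
def IsDimensionalMatching {d : ℕ} (M : (hypercube d).Subgraph) : Prop :=
  M.IsPerfectMatching ∧
    Nonempty ((hypercube d).deleteEdges M.edgeSet ≃g
      (SimpleGraph.sum (hypercube (d - 1)) (hypercube (d - 1))))

/-- A `d`-edge precoloring of `Q_d`, i.e. a proper partial edge coloring with `d` colors;
`φ e = none` means that `e` is not colored. -/
def IsPrecoloring {d : ℕ} (φ : (hypercube d).edgeSet → Option (Fin d)) : Prop :=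
  ∀ e f : (hypercube d).edgeSet, (hypercube d).lineGraph.Adj e f →
    ∀ c : Fin d, φ e = some c → φ f ≠ some c

/-- The density conditions on a precoloring of `Q_d`. -/
structure IsDense {d : ℕ} (α : ℝ) (φ : (hypercube d).edgeSet → Option (Fin d)) : Prop where
  /-- At most `α d` edges at each vertex are precolored. -/
  vertex : ∀ v : Fin d → Bool,
    ({e : (hypercube d).edgeSet | v ∈ (e : Sym2 (Fin d → Bool)) ∧ φ e ≠ none}.ncard : ℝ) ≤ α * d
  /-- At most `α d` edges in each `27`-neighborhood are precolored with any given color. -/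
  color : ∀ (e : (hypercube d).edgeSet) (c : Fin d),
    ({f : (hypercube d).edgeSet | f ∈ edgeNeighborhood (hypercube d) 27 e ∧ φ f = some c}.ncard : ℝ) ≤ α * d
  /-- At most `α d` edges of each dimensional matching are precolored in each
  `27`-neighborhood. -/
  matching : ∀ (e : (hypercube d).edgeSet) (M : (hypercube d).Subgraph),
    IsDimensionalMatching M →
    ({f : (hypercube d).edgeSet | f ∈ edgeNeighborhood (hypercube d) 27 e ∧
      (f : Sym2 (Fin d → Bool)) ∈ M.edgeSet ∧ φ f ≠ none}.ncard : ℝ) ≤ α * d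

/-- The sparsity conditions on an assignment of lists of (forbidden) colors to the edges
of `Q_d`. -/
structure IsSparse {d : ℕ} (β : ℝ) (L : (hypercube d).edgeSet → Finset (Fin d)) : Prop where
  /-- Each list has at most `β d` colors. -/
  edge : ∀ e : (hypercube d).edgeSet, ((L e).card : ℝ) ≤ β * d
  /-- Each color occurs in at most `β d` lists of edges incident to any given vertex. -/
  vertex : ∀ (v : Fin d → Bool) (c : Fin d),
    ({e : (hypercube d).edgeSet | v ∈ (e : Sym2 (Fin d → Bool)) ∧ c ∈ L e}.ncard : ℝ) ≤ β * d
  /-- Each color occurs at most `β d` times in lists of edges of any given dimensional matching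
  contained in any given `27`-neighborhood. -/
  matching : ∀ (e : (hypercube d).edgeSet) (M : (hypercube d).Subgraph),
    IsDimensionalMatching M → ∀ c : Fin d,
    ({f : (hypercube d).edgeSet | f ∈ edgeNeighborhood (hypercube d) 27 e ∧
      (f : Sym2 (Fin d → Bool)) ∈ M.edgeSet ∧ c ∈ L f}.ncard : ℝ) ≤ β * d

/-!
The edge at the vertex `v` in direction `i` is written `(v, i)`, and `v + i` is the neighbour `fl v i`.
After a renaming of the colors, every edge is first given its direction as its color. This standard
coloring is repaired by exchanging the two colors on two-colored `4`-cycles; recolorings on disjoint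
sets of edges can be carried out at the same time (`exists_merge`).

**Choice of the renaming.** By a first moment argument over all permutations
(`exists_perm_few_hits`) the renaming can be chosen such that, in addition to the sparsity that
is assumed, at every vertex few edges have a forbidden color, few edges parallel and close to a
given edge forbid the direction that leads to them, and few edges `(v, j)` are followed, at `v + j`,
by an edge with prescribed color `j`. All conditions then say that certain local counts are at
most `t`, where `d` is a huge multiple of `t` (`LocallySparse`, `exists_locallySparse`).

**First stage.** Call an edge bad if its color is forbidden, if its color differs from its
prescribed color, or if its color is prescribed for an adjacent edge. Every bad edge `(v, i)` picks a
direction `k = κ v i` and exchanges the colors on the `4`-cycle through `v` in the directions `i`, `k`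
(`exists_firstStage`). The result avoids all forbidden colors. The bad edges themselves may be
precolored and may require each other's colors in long chains; but now a color `j` prescribed for an
edge at `v` sits on the edge `(v, κ v j)`, which is not precolored and is not used by any other
bad edge.

**Second stage.** For every edge `(v, i)` that still lacks its prescribed color `j`, and for any
direction `m` at which its surroundings are still standard, six exchanges move the color `j` to the
direction `m` at both endpoints, and then to the edge (`IsProper.exists_gadget`). Apart
from the edge and the two edges that carried the color `j`, all edges concerned depend on `m`.

**Disjointness.** In both stages there are at least `d / 2` admissible directions for every
edge, and the directions must be chosen such that the gadgets are disjoint; after the first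
stage it is also needed that the `4`-cycles are spread evenly. Both follow from one lemma
(`exists_disjoint_gadgets`): a choice that minimizes a weighted number of crowding and clashing
pairs has few crowding pairs everywhere, and hence no clashing ones.
-/

namespace HypercubeColoring

/-! ### Vertices, directions, and exchanges on 4-cycles -/

section

variable {d : ℕ}

/-- The neighbour of the vertex `v` of the hypercube in direction `i`. -/
def fl (v : Fin d → Bool) (i : Fin d) : Fin d → Bool := Function.update v i (!v i)

lemma fl_apply (v : Fin d → Bool) (i l : Fin d) : fl v i l = if l = i then !v i else v l := by
  simp [fl, Function.update_apply]

@[simp] lemma fl_same (v : Fin d → Bool) (i : Fin d) : fl v i i = !v i := by simp [fl_apply]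

lemma fl_of_ne (v : Fin d → Bool) {i l : Fin d} (h : l ≠ i) : fl v i l = v l := by
  simp [fl_apply, h]

@[simp] lemma fl_fl (v : Fin d → Bool) (i : Fin d) : fl (fl v i) i = v := by
  funext l; by_cases h : l = i <;> simp [fl_apply, h]

lemma fl_comm (v : Fin d → Bool) (i j : Fin d) : fl (fl v i) j = fl (fl v j) i := by
  funext l
  by_cases h : l = i <;> by_cases h' : l = j <;> by_cases h'' : i = j <;> simp_all [fl_apply]

lemma fl_ne (v : Fin d → Bool) (i : Fin d) : fl v i ≠ v := fun h => by
  have := congrFun h i; simp at this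

lemma fl_eq_iff {v w : Fin d → Bool} {i : Fin d} : fl v i = w ↔ v = fl w i := by
  constructor
  · rintro rfl; simp
  · rintro rfl; simp

lemma fl_inj_left {v w : Fin d → Bool} {i : Fin d} : fl v i = fl w i ↔ v = w := by
  rw [fl_eq_iff, fl_fl]

lemma fl_inj_right {v : Fin d → Bool} {i j : Fin d} : fl v i = fl v j ↔ i = j := by
  constructor
  · intro h
    by_contra hne
    have := congrFun h i
    rw [fl_same, fl_of_ne _ hne] at this
    simp at this
  · rintro rfl; rfl

lemma hammingDist_fl_self (v : Fin d → Bool) (i : Fin d) : hammingDist (fl v i) v = 1 := by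
  have : (Finset.univ.filter fun l => fl v i l ≠ v l) = {i} := by
    ext l
    by_cases h : l = i
    · subst h; simp
    · simp [fl_of_ne _ h, h]
  rw [hammingDist, this, Finset.card_singleton]

lemma hammingDist_fl_le (v w : Fin d → Bool) (i : Fin d) :
    hammingDist (fl v i) w ≤ hammingDist v w + 1 := by
  have := hammingDist_triangle (fl v i) v w
  rw [hammingDist_fl_self] at this; omega

lemma hammingDist_le_fl (v w : Fin d → Bool) (i : Fin d) :
    hammingDist v w ≤ hammingDist (fl v i) w + 1 := by
  have := hammingDist_fl_le (fl v i) w i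
  rwa [fl_fl] at this

/-- A proper `d`-edge coloring of the hypercube, as a function of a vertex and a direction. -/
structure IsProper (f : (Fin d → Bool) → Fin d → Fin d) : Prop where
  symm : ∀ v i, f (fl v i) i = f v i
  inj : ∀ v, Function.Injective (f v)

/-- `SameEdge w l v i`: the vertex-direction pairs `(w, l)` and `(v, i)` describe the same edge. -/
def SameEdge (w : Fin d → Bool) (l : Fin d) (v : Fin d → Bool) (i : Fin d) : Prop :=
  l = i ∧ (w = v ∨ w = fl v i)

/-- `InSq v a b w`: the vertex `w` lies on the `4`-cycle through `v` in the directions `a`, `b`. -/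
def InSq (v : Fin d → Bool) (a b : Fin d) (w : Fin d → Bool) : Prop :=
  ∀ l, l ≠ a → l ≠ b → w l = v l

lemma inSq_iff {v : Fin d → Bool} {a b : Fin d} {w : Fin d → Bool} :
    InSq v a b w ↔ w = v ∨ w = fl v a ∨ w = fl v b ∨ w = fl (fl v a) b := by
  constructor
  · intro h
    by_cases hab : a = b
    · subst hab
      by_cases ha : w a = v a
      · left; funext l
        by_cases hl : l = a
        · rw [hl, ha]
        · exact h l hl hl
      · right; left; funext l
        by_cases hl : l = a
        · rw [hl, fl_same]; revert ha; cases w a <;> cases v a <;> simp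
        · rw [fl_of_ne _ hl]; exact h l hl hl
    · have key : ∀ u : Fin d → Bool, w a = u a → w b = u b → (∀ l, l ≠ a → l ≠ b → u l = v l) →
          w = u := by
        intro u h1 h2 h3
        funext l
        by_cases hla : l = a
        · rw [hla, h1]
        · by_cases hlb : l = b
          · rw [hlb, h2]
          · rw [h l hla hlb, h3 l hla hlb]
      have hne : ∀ x y : Bool, x ≠ y → x = !y := by decide
      by_cases h1 : w a = v a <;> by_cases h2 : w b = v b
      · exact Or.inl (key v h1 h2 fun _ _ _ => rfl)
      · refine Or.inr (Or.inr (Or.inl (key _ ?_ ?_ ?_)))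
        · rw [fl_of_ne _ hab, h1]
        · rw [fl_same]; exact hne _ _ h2
        · intro l _ hl; rw [fl_of_ne _ hl]
      · refine Or.inr (Or.inl (key _ ?_ ?_ ?_))
        · rw [fl_same]; exact hne _ _ h1
        · rw [fl_of_ne _ (Ne.symm hab), h2]
        · intro l hl _; rw [fl_of_ne _ hl]
      · refine Or.inr (Or.inr (Or.inr (key _ ?_ ?_ ?_)))
        · rw [fl_of_ne _ hab, fl_same]; exact hne _ _ h1
        · rw [fl_same, fl_of_ne _ (Ne.symm hab)]; exact hne _ _ h2
        · intro l hl hl'; rw [fl_of_ne _ hl', fl_of_ne _ hl]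
  · rintro (rfl | rfl | rfl | rfl) l ha hb
    · rfl
    · rw [fl_of_ne _ ha]
    · rw [fl_of_ne _ hb]
    · rw [fl_of_ne _ hb, fl_of_ne _ ha]

lemma inSq_self (v : Fin d → Bool) (a b : Fin d) : InSq v a b v := fun _ _ _ => rfl

lemma InSq.fl_iff {v : Fin d → Bool} {a b : Fin d} {w : Fin d → Bool} {l : Fin d}
    (h : l = a ∨ l = b) : InSq v a b (fl w l) ↔ InSq v a b w := by
  unfold InSq
  refine forall_congr' fun x => ?_
  refine imp_congr_right fun ha => imp_congr_right fun hb => ?_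
  rw [fl_of_ne]
  rintro rfl
  tauto

open Classical in
/-- The coloring that arises from `f` by exchanging the colors of the directions `a` and `b` on
the `4`-cycle through `v` in these directions. -/
noncomputable def sq (f : (Fin d → Bool) → Fin d → Fin d) (v : Fin d → Bool) (a b : Fin d) :
    (Fin d → Bool) → Fin d → Fin d :=
  fun w l => if InSq v a b w then f w (Equiv.swap a b l) else f w l

section sq
variable {f : (Fin d → Bool) → Fin d → Fin d} {v : Fin d → Bool} {a b : Fin d}

lemma sq_of_not_inSq {w : Fin d → Bool} (h : ¬ InSq v a b w) (l : Fin d) :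
    sq f v a b w l = f w l := by simp [sq, h]

lemma sq_of_ne {l : Fin d} (w : Fin d → Bool) (ha : l ≠ a) (hb : l ≠ b) :
    sq f v a b w l = f w l := by
  simp only [sq, Equiv.swap_apply_of_ne_of_ne ha hb, ite_self]

lemma sq_left {w : Fin d → Bool} (h : InSq v a b w) : sq f v a b w a = f w b := by
  simp [sq, h]

lemma sq_right {w : Fin d → Bool} (h : InSq v a b w) : sq f v a b w b = f w a := by
  simp [sq, h]

/-- The `4`-cycle through `v` in the directions `a`, `b` is two-colored. -/
lemma IsProper.eq_of_inSq (hf : IsProper f) (h1 : f (fl v a) b = f v b)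
    (h2 : f (fl v b) a = f v a) {w : Fin d → Bool} (h : InSq v a b w) :
    f w a = f v a ∧ f w b = f v b := by
  rcases inSq_iff.1 h with rfl | rfl | rfl | rfl
  · exact ⟨rfl, rfl⟩
  · exact ⟨hf.symm _ _, h1⟩
  · exact ⟨h2, hf.symm _ _⟩
  · refine ⟨?_, ?_⟩
    · rw [fl_comm, hf.symm, h2]
    · rw [hf.symm, h1]

/-- Exchanging the two colors of a two-colored `4`-cycle keeps the coloring proper. -/
lemma IsProper.sq (hf : IsProper f) (h1 : f (fl v a) b = f v b) (h2 : f (fl v b) a = f v a) :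
    IsProper (sq f v a b) where
  symm w l := by
    by_cases hl : l = a ∨ l = b
    · by_cases h : InSq v a b w
      · have h' : InSq v a b (fl w l) := (InSq.fl_iff hl).2 h
        have e1 := hf.eq_of_inSq h1 h2 h
        have e2 := hf.eq_of_inSq h1 h2 h'
        rcases hl with rfl | rfl
        · rw [sq_left h', sq_left h, e2.2, e1.2]
        · rw [sq_right h', sq_right h, e2.1, e1.1]
      · have h' : ¬ InSq v a b (fl w l) := fun x => h ((InSq.fl_iff hl).1 x)
        rw [sq_of_not_inSq h', sq_of_not_inSq h, hf.symm]
    · push Not at hl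
      rw [sq_of_ne _ hl.1 hl.2, sq_of_ne _ hl.1 hl.2, hf.symm]
  inj w := by
    by_cases h : InSq v a b w
    · have : HypercubeColoring.sq f v a b w = f w ∘ Equiv.swap a b := by
        funext l; simp [HypercubeColoring.sq, h]
      rw [this]
      exact (hf.inj w).comp (Equiv.injective _)
    · have : HypercubeColoring.sq f v a b w = f w := by
        funext l; simp [HypercubeColoring.sq, h]
      rw [this]; exact hf.inj w

lemma IsProper.sq_cases (hf : IsProper f) (h1 : f (fl v a) b = f v b)
    (h2 : f (fl v b) a = f v a) (w : Fin d → Bool) (l : Fin d) :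
    HypercubeColoring.sq f v a b w l = f w l ∨ InSq v a b w ∧
      (l = a ∧ HypercubeColoring.sq f v a b w l = f v b ∨
        l = b ∧ HypercubeColoring.sq f v a b w l = f v a) := by
  by_cases h : InSq v a b w
  · have e1 := hf.eq_of_inSq h1 h2 h
    by_cases ha : l = a
    · subst ha; right; exact ⟨h, Or.inl ⟨rfl, by rw [sq_left h, e1.2]⟩⟩
    · by_cases hb : l = b
      · subst hb; right; exact ⟨h, Or.inr ⟨rfl, by rw [sq_right h, e1.1]⟩⟩
      · left; exact sq_of_ne _ ha hb
  · left; exact sq_of_not_inSq h l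

end sq

/-- Recolorings of a proper coloring that change pairwise disjoint sets of edges can be carried
out simultaneously: at every vertex, each of them permutes the colors of the edges it changes. -/
theorem exists_merge {ι : Type*} {f : (Fin d → Bool) → Fin d → Fin d} (hf : IsProper f)
    {F : ι → (Fin d → Bool) → Fin d → Fin d} (hF : ∀ x, IsProper (F x))
    (hdis : ∀ x y, x ≠ y → ∀ w l, F x w l ≠ f w l → F y w l = f w l) :
    ∃ g, IsProper g ∧ (∀ x w l, F x w l ≠ f w l → g w l = F x w l) ∧
      ∀ w l, (∀ x, F x w l = f w l) → g w l = f w l := by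
  classical
  have hg : ∀ w l, ∃ c, (∀ x, F x w l ≠ f w l → c = F x w l) ∧
      ((∀ x, F x w l = f w l) → c = f w l) := by
    intro w l
    by_cases h : ∃ x, F x w l ≠ f w l
    · obtain ⟨x, hx⟩ := h
      refine ⟨F x w l, fun y hy => ?_, fun h => h x⟩
      by_cases hxy : x = y
      · rw [hxy]
      · exact absurd (hdis x y hxy w l hx) hy
    · push Not at h
      exact ⟨f w l, fun x hx => absurd (h x) hx, fun _ => rfl⟩
  choose g hg1 hg2 using hg
  refine ⟨g, ⟨fun v i => ?_, fun v => ?_⟩, fun x w l h => hg1 w l x h, hg2⟩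
  · by_cases h : ∃ x, F x v i ≠ f v i
    · obtain ⟨x, hx⟩ := h
      have hx' : F x (fl v i) i ≠ f (fl v i) i := by
        rw [(hF x).symm, hf.symm]; exact hx
      rw [hg1 _ _ x hx, hg1 _ _ x hx', (hF x).symm]
    · push Not at h
      rw [hg2 _ _ h, hg2 _ _, hf.symm]
      intro x; rw [(hF x).symm, hf.symm, h x]
  · -- a changed edge takes the old color of an edge changed by the same recoloring
    have key : ∀ x a, F x v a ≠ f v a → ∃ b, F x v b ≠ f v b ∧ f v b = F x v a := by
      intro x a hxa
      obtain ⟨b, hb⟩ := (Finite.injective_iff_surjective.1 (hf.inj v)) (F x v a)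
      refine ⟨b, fun h => hxa ?_, hb⟩
      have : b = a := (hF x).inj v (by rw [h, hb])
      rw [← hb, this]
    intro a b hab
    by_cases ha : ∃ x, F x v a ≠ f v a
    · obtain ⟨x, hx⟩ := ha
      obtain ⟨a', ha', ea⟩ := key x a hx
      rw [hg1 _ _ x hx] at hab
      by_cases hb : ∃ y, F y v b ≠ f v b
      · obtain ⟨y, hy⟩ := hb
        obtain ⟨b', hb', eb⟩ := key y b hy
        rw [hg1 _ _ y hy] at hab
        have : a' = b' := hf.inj v (by rw [ea, eb, hab])
        subst this
        by_cases hxy : x = y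
        · subst hxy; exact (hF x).inj v hab
        · exact absurd (hdis x y hxy _ _ ha') hb'
      · push Not at hb
        rw [hg2 _ _ hb] at hab
        have : a' = b := hf.inj v (by rw [ea, hab])
        subst this
        exact absurd (hb x) ha'
    · push Not at ha
      rw [hg2 _ _ ha] at hab
      by_cases hb : ∃ y, F y v b ≠ f v b
      · obtain ⟨y, hy⟩ := hb
        obtain ⟨b', hb', eb⟩ := key y b hy
        rw [hg1 _ _ y hy] at hab
        have : b' = a := hf.inj v (by rw [eb, hab])
        subst this
        exact absurd (ha y) hb'
      · push Not at hb
        rw [hg2 _ _ hb] at hab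
        exact hf.inj v hab

end

/-! ### Counting, and gadgets with a free direction -/

section

variable {d : ℕ}

/-- Double counting: if every element of `S` is related to an element of `T`, and every element
of `T` to at most `n` elements of `S`, then `S` has at most `n` times as many elements as `T`. -/
lemma ncard_le_mul_of_rel {α β : Type*} [Finite α] [Finite β] {S : Set α} {T : Set β}
    (r : α → β → Prop) {k n : ℕ} (hT : T.ncard ≤ k)
    (hn : ∀ b ∈ T, {a | a ∈ S ∧ r a b}.ncard ≤ n) (h : ∀ a ∈ S, ∃ b ∈ T, r a b) :
    S.ncard ≤ k * n := by
  classical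
  have hfin : T.Finite := Set.toFinite T
  have hsub : S ⊆ ⋃ b ∈ hfin.toFinset, {a | a ∈ S ∧ r a b} := by
    intro a ha
    obtain ⟨b, hb, hab⟩ := h a ha
    simp only [Set.mem_iUnion]
    exact ⟨b, by simpa using hb, ha, hab⟩
  calc S.ncard ≤ (⋃ b ∈ hfin.toFinset, {a | a ∈ S ∧ r a b}).ncard :=
        Set.ncard_le_ncard hsub (Set.toFinite _)
    _ ≤ ∑ b ∈ hfin.toFinset, {a | a ∈ S ∧ r a b}.ncard := Finset.set_ncard_biUnion_le _ _
    _ ≤ ∑ _b ∈ hfin.toFinset, n := Finset.sum_le_sum fun b hb => hn b (by simpa using hb)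
    _ = T.ncard * n := by rw [Finset.sum_const, smul_eq_mul, Set.ncard_eq_toFinset_card T hfin]
    _ ≤ k * n := Nat.mul_le_mul_right _ hT

lemma ncard_le_of_inj_rel {α β : Type*} [Finite α] [Finite β] {S : Set α} {T : Set β}
    (r : α → β → Prop) {k : ℕ} (hT : T.ncard ≤ k)
    (hn : ∀ b ∈ T, ∀ a ∈ S, ∀ a' ∈ S, r a b → r a' b → a = a')
    (h : ∀ a ∈ S, ∃ b ∈ T, r a b) : S.ncard ≤ k := by
  have := ncard_le_mul_of_rel (S := S) (T := T) r (n := 1) hT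
    (fun b hb => (Set.ncard_le_one (Set.toFinite _)).2
      fun a ha a' ha' => hn b hb a ha.1 a' ha'.1 ha.2 ha'.2) h
  simpa using this

lemma ncard_le_of_imp {α : Type*} [Finite α] {p q : α → Prop} {k : ℕ}
    (h : {a | q a}.ncard ≤ k) (hpq : ∀ a, p a → q a) : {a | p a}.ncard ≤ k :=
  (Set.ncard_le_ncard (fun a ha => hpq a ha) (Set.toFinite _)).trans h

lemma ncard_or_le {α : Type*} [Finite α] {p q : α → Prop} {k l : ℕ}
    (hp : {a | p a}.ncard ≤ k) (hq : {a | q a}.ncard ≤ l) : {a | p a ∨ q a}.ncard ≤ k + l := by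
  have := Set.ncard_union_le {a | p a} {a | q a}
  rw [show {a | p a} ∪ {a | q a} = {a | p a ∨ q a} from rfl] at this
  omega

/-- Union bound over a finite set of cases. -/
lemma ncard_exists_mem_le {α κ : Type*} [Finite α] (I : Finset κ) {p : κ → α → Prop} {n : ℕ}
    (h : ∀ k ∈ I, {a | p k a}.ncard ≤ n) : {a | ∃ k ∈ I, p k a}.ncard ≤ I.card * n := by
  have : {a | ∃ k ∈ I, p k a} = ⋃ k ∈ I, {a | p k a} := by ext; simp
  rw [this]
  refine (Finset.set_ncard_biUnion_le _ _).trans ?_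
  simpa using Finset.sum_le_card_nsmul I _ n h

lemma ncard_fl_eq_le_one (v w : Fin d → Bool) : {a | fl v a = w}.ncard ≤ 1 := by
  rw [Set.ncard_le_one (Set.toFinite _)]
  rintro a ha b hb
  exact fl_inj_right.1 (ha.trans hb.symm)

lemma ncard_eq_le_one {α : Type*} [Finite α] (b : α) : {a | a = b}.ncard ≤ 1 := by simp

/-- A choice of one option for each item minimizing the total pairwise cost: no item can lower
its own cost by switching to another option. -/
lemma exists_locally_optimal {ι O : Type*} [Fintype ι] [DecidableEq ι] [Fintype O]
    (A : ι → Finset O) (hA : ∀ x, (A x).Nonempty) (w : ι → O → ι → O → ℕ)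
    (hw : ∀ x a y b, w x a y b = w y b x a) :
    ∃ o : ι → O, (∀ x, o x ∈ A x) ∧ ∀ x, ∀ a ∈ A x,
      ∑ y ∈ Finset.univ.erase x, w x (o x) y (o y) ≤ ∑ y ∈ Finset.univ.erase x, w x a y (o y) := by
  classical
  let Φ : (ι → O) → ℕ := fun o => ∑ x, ∑ y ∈ Finset.univ.erase x, w x (o x) y (o y)
  obtain ⟨o, ho, hmin⟩ := Finset.exists_min_image (Fintype.piFinset A) Φ
    (Fintype.piFinset_nonempty.2 hA)
  rw [Fintype.mem_piFinset] at ho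
  refine ⟨o, ho, fun x a ha => ?_⟩
  have h := hmin (Function.update o x a) (by
    rw [Fintype.mem_piFinset]
    intro y
    by_cases hy : y = x
    · subst hy; simpa using ha
    · simpa [Function.update_of_ne hy] using ho y)
  -- split the cost into the part that involves `x`, counted twice, and the rest
  have split : ∀ o' : ι → O, Φ o' = 2 * ∑ y ∈ Finset.univ.erase x, w x (o' x) y (o' y) +
      ∑ z ∈ Finset.univ.erase x, ∑ y ∈ (Finset.univ.erase z).erase x, w z (o' z) y (o' y) := by
    intro o'
    have h1 : Φ o' = ∑ y ∈ Finset.univ.erase x, w x (o' x) y (o' y) +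
        ∑ z ∈ Finset.univ.erase x, ∑ y ∈ Finset.univ.erase z, w z (o' z) y (o' y) :=
      (Finset.add_sum_erase Finset.univ
        (fun z => ∑ y ∈ Finset.univ.erase z, w z (o' z) y (o' y)) (Finset.mem_univ x)).symm
    have h2 : ∑ z ∈ Finset.univ.erase x, ∑ y ∈ Finset.univ.erase z, w z (o' z) y (o' y) =
        ∑ z ∈ Finset.univ.erase x, (w x (o' x) z (o' z) +
          ∑ y ∈ (Finset.univ.erase z).erase x, w z (o' z) y (o' y)) := by
      refine Finset.sum_congr rfl fun z hz => ?_
      have hx : x ∈ Finset.univ.erase z := by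
        simpa using (Finset.ne_of_mem_erase hz).symm
      rw [← Finset.add_sum_erase _ (fun y => w z (o' z) y (o' y)) hx, hw z]
    rw [h1, h2, Finset.sum_add_distrib]; ring
  rw [split, split (Function.update o x a)] at h
  have e1 : ∑ y ∈ Finset.univ.erase x,
      w x (Function.update o x a x) y (Function.update o x a y) =
      ∑ y ∈ Finset.univ.erase x, w x a y (o y) := by
    refine Finset.sum_congr rfl fun y hy => ?_
    rw [Function.update_self, Function.update_of_ne (Finset.ne_of_mem_erase hy)]
  have e2 : ∑ z ∈ Finset.univ.erase x, ∑ y ∈ (Finset.univ.erase z).erase x,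
      w z (Function.update o x a z) y (Function.update o x a y) =
      ∑ z ∈ Finset.univ.erase x, ∑ y ∈ (Finset.univ.erase z).erase x, w z (o z) y (o y) := by
    refine Finset.sum_congr rfl fun z hz => Finset.sum_congr rfl fun y hy => ?_
    rw [Function.update_of_ne (Finset.ne_of_mem_erase hz),
      Function.update_of_ne (Finset.ne_of_mem_erase hy)]
  rw [e1, e2] at h
  omega

/-- The edges `(z, m)` with `z ∈ Z` and `(z + m, l)` with `z ∈ Z` and `l ∈ Λ`, where `z + m` is
the neighbour of `z` in direction `m`: the edges of a gadget that depend on the free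
direction `m`. -/
def Gen (Z : Finset (Fin d → Bool)) (Λ : Finset (Fin d)) (m : Fin d)
    (w : Fin d → Bool) (l : Fin d) : Prop :=
  l = m ∧ (w ∈ Z ∨ fl w m ∈ Z) ∨ l ∈ Λ ∧ (fl w m ∈ Z ∨ fl (fl w m) l ∈ Z)

lemma Gen.flip {Z : Finset (Fin d → Bool)} {Λ : Finset (Fin d)} {m : Fin d}
    {w : Fin d → Bool} {l : Fin d} (h : Gen Z Λ m w l) : Gen Z Λ m (fl w l) l := by
  rcases h with ⟨rfl, h⟩ | ⟨hl, h⟩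
  · left; simpa [or_comm] using h
  · right
    refine ⟨hl, ?_⟩
    rw [fl_comm w l m, fl_fl, or_comm]; exact h

open Classical in
/-- The vertices of `Z` and their neighbours in the directions of `Λ`. Every edge of `Gen Z Λ m`
joins vertices `y` and `y + m`, or has both ends of the form `y + m`, with `y ∈ reach Z Λ`. -/
noncomputable def reach (Z : Finset (Fin d → Bool)) (Λ : Finset (Fin d)) :
    Finset (Fin d → Bool) :=
  Z ∪ Finset.image₂ fl Z Λ

lemma subset_reach {Z : Finset (Fin d → Bool)} {Λ : Finset (Fin d)} {z : Fin d → Bool}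
    (h : z ∈ Z) : z ∈ reach Z Λ := by simp [reach, h]

lemma mem_reach_of_fl {Z : Finset (Fin d → Bool)} {Λ : Finset (Fin d)} {z : Fin d → Bool}
    {l : Fin d} (hl : l ∈ Λ) (h : fl z l ∈ Z) : z ∈ reach Z Λ := by
  simp only [reach, Finset.mem_union, Finset.mem_image₂]
  exact Or.inr ⟨_, h, l, hl, fl_fl z l⟩

lemma card_reach_le {Z : Finset (Fin d → Bool)} {Λ : Finset (Fin d)} {c : ℕ} (hZ : Z.card ≤ c)
    (hΛ : Λ.card ≤ c) : (reach Z Λ).card ≤ c + c * c := by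
  refine (Finset.card_union_le _ _).trans (Nat.add_le_add hZ ?_)
  exact (Finset.card_image₂_le _ _ _).trans (Nat.mul_le_mul hZ hΛ)

lemma hammingDist_le_of_mem_reach {Z : Finset (Fin d → Bool)} {Λ : Finset (Fin d)}
    {b z : Fin d → Bool} {r : ℕ} (hZ : ∀ z ∈ Z, hammingDist z b ≤ r) (hz : z ∈ reach Z Λ) :
    hammingDist z b ≤ r + 1 := by
  simp only [reach, Finset.mem_union, Finset.mem_image₂] at hz
  rcases hz with hz | ⟨y, hy, l, -, rfl⟩
  · exact (hZ z hz).trans (Nat.le_succ r)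
  · exact (hammingDist_fl_le _ _ _).trans (Nat.succ_le_succ (hZ y hy))

/-- If the gadgets of two items share an edge, then either the two items meet and the option `a` of
the first item is one of few directions that are determined by the second one, or the option `b`
of the second item or one of its fixed directions is a fixed direction of the first item, and the
option `a` is determined up to a bounded number of possibilities. In both cases there are few such
items and, for each of them, few such options `a`. -/
lemma conflict_cases {Z Z' : Finset (Fin d → Bool)} {Λ Λ' : Finset (Fin d)} {a b : Fin d}
    {w : Fin d → Bool} {l : Fin d} (h : Gen Z Λ a w l) (h' : Gen Z' Λ' b w l) :
    ((a = b ∨ a ∈ Λ') ∧ ∃ z ∈ Z, z ∈ Z' ∨ fl z b ∈ reach Z' Λ') ∨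
    ((b ∈ Λ ∨ ∃ l ∈ Λ, l ∈ Λ') ∧ ∃ z ∈ Z, ∃ z' ∈ reach Z' Λ', fl z a = z' ∨ fl z a = fl z' b) := by
  rcases h with ⟨rfl, h⟩ | ⟨hl, h⟩ <;> rcases h' with ⟨rfl, h'⟩ | ⟨hl', h'⟩
  · left
    refine ⟨Or.inl rfl, ?_⟩
    rcases h with h | h
    · exact ⟨w, h, h'.imp id subset_reach⟩
    · refine ⟨_, h, ?_⟩
      rw [fl_fl, or_comm]
      exact h'.imp subset_reach id
  · left
    refine ⟨Or.inr hl', ?_⟩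
    rcases h with h | h
    · refine ⟨w, h, Or.inr ?_⟩
      rcases h' with h' | h'
      · exact subset_reach h'
      · exact mem_reach_of_fl hl' h'
    · refine ⟨_, h, Or.inr ?_⟩
      rw [fl_comm]
      rcases h' with h' | h'
      · refine mem_reach_of_fl hl' ?_
        rwa [fl_fl]
      · exact subset_reach h'
  · right
    refine ⟨Or.inl hl, ?_⟩
    rcases h with h | h
    · refine ⟨_, h, ?_⟩
      rw [fl_fl]
      rcases h' with h' | h'
      · exact ⟨w, subset_reach h', Or.inl rfl⟩
      · exact ⟨_, subset_reach h', Or.inr (by rw [fl_fl])⟩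
    · refine ⟨_, h, ?_⟩
      rw [fl_comm w, fl_fl]
      rcases h' with h' | h'
      · exact ⟨w, subset_reach h', Or.inr rfl⟩
      · exact ⟨_, subset_reach h', Or.inl rfl⟩
  · right
    refine ⟨Or.inr ⟨l, hl, hl'⟩, ?_⟩
    have hr : fl w b ∈ reach Z' Λ' := by
      rcases h' with h' | h'
      · exact subset_reach h'
      · exact mem_reach_of_fl hl' h'
    have hr' : fl (fl w l) b ∈ reach Z' Λ' := by
      rw [fl_comm]
      rcases h' with h' | h'
      · exact mem_reach_of_fl hl' (by rwa [fl_fl])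
      · exact subset_reach h'
    rcases h with h | h
    · exact ⟨_, h, _, hr, Or.inr (by rw [fl_fl, fl_fl])⟩
    · exact ⟨_, h, _, hr', Or.inr (by rw [fl_comm w a l, fl_fl, fl_fl])⟩

end

/-! ### Balanced choice of disjoint gadgets -/

section

variable {d : ℕ}

/-- Double counting of a relation all of whose pairs lie over a small set `Y`. -/
lemma sum_ncard_le {O ι : Type*} [Fintype O] [Fintype ι] (A : Finset O) (r : O → ι → Prop)
    {Y : Set ι} {k n : ℕ} (hY : Y.ncard ≤ k) (hsub : ∀ a y, r a y → y ∈ Y)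
    (hfib : ∀ y ∈ Y, {a | r a y}.ncard ≤ n) : ∑ a ∈ A, {y | r a y}.ncard ≤ k * n := by
  classical
  have h1 : ∀ a, {y | r a y}.ncard = ∑ y, if r a y then 1 else 0 := by
    intro a
    rw [Set.ncard_eq_toFinset_card']
    simp
  have h2 : ∀ y, {a | r a y}.ncard = ∑ a, if r a y then 1 else 0 := by
    intro y
    rw [Set.ncard_eq_toFinset_card']
    simp
  calc ∑ a ∈ A, {y | r a y}.ncard = ∑ a ∈ A, ∑ y, if r a y then 1 else 0 := by simp_rw [h1]
    _ ≤ ∑ a, ∑ y, if r a y then 1 else 0 :=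
      Finset.sum_le_sum_of_subset (Finset.subset_univ A)
    _ = ∑ y, {a | r a y}.ncard := by rw [Finset.sum_comm]; simp_rw [h2]
    _ ≤ ∑ y, if y ∈ Y then n else 0 := by
      refine Finset.sum_le_sum fun y _ => ?_
      by_cases hy : y ∈ Y
      · simpa [hy] using hfib y hy
      · have : {a | r a y} = ∅ := by
          ext a; simp only [Set.mem_ofPred_eq, Set.mem_empty_iff_false, iff_false]
          exact fun h => hy (hsub a y h)
        simp [this]
    _ = Y.ncard * n := by
      rw [← Finset.sum_filter, Finset.sum_const, smul_eq_mul, Set.ncard_eq_toFinset_card']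
      congr 2; ext; simp
    _ ≤ k * n := Nat.mul_le_mul_right _ hY

section stage

variable {ι : Type*} [Fintype ι] {c t r R C : ℕ} {base : ι → Fin d → Bool}
  {Z : ι → Finset (Fin d → Bool)} {Λ : ι → Finset (Fin d)}

/-- The relation whose degrees measure how unevenly the options are spread: two close items use
the same option, or two items reach a common vertex. -/
def Crowds (R : ℕ) (base : ι → Fin d → Bool) (Z : ι → Finset (Fin d → Bool))
    (Λ : ι → Finset (Fin d)) (x : ι) (a : Fin d) (y : ι) (b : Fin d) : Prop :=
  (hammingDist (base x) (base y) ≤ 2 * R ∧ a = b) ∨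
    ∃ z ∈ reach (Z x) (Λ x), ∃ z' ∈ reach (Z y) (Λ y), fl z a = fl z' b

/-- Two gadgets have an edge in common. -/
def Clash (Z : ι → Finset (Fin d → Bool)) (Λ : ι → Finset (Fin d)) (x : ι) (a : Fin d) (y : ι)
    (b : Fin d) : Prop :=
  ∃ w l, Gen (Z x) (Λ x) a w l ∧ Gen (Z y) (Λ y) b w l

/-- The total number of items that crowd `x`, over all options of `x`. -/
lemma sum_crowds_le (hZc : ∀ x, (Z x).card ≤ c) (hΛc : ∀ x, (Λ x).card ≤ c)
    (hZb : ∀ x, ∀ z ∈ Z x, hammingDist z (base x) ≤ r) (hR : 2 * r + 4 ≤ R)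
    (h3 : ∀ w, {x | hammingDist (base x) w ≤ 2 * R}.ncard ≤ t * d)
    (o : ι → Fin d) (A : Finset (Fin d)) (x : ι) :
    ∑ a ∈ A, {y | y ≠ x ∧ Crowds R base Z Λ x a y (o y)}.ncard ≤
      t * d * (1 + (c + c * c) * (c + c * c)) := by
  refine sum_ncard_le A _ (h3 (base x)) ?_ ?_
  · rintro a y ⟨-, ⟨h, -⟩ | ⟨z, hz, z', hz', h⟩⟩
    · simpa [hammingDist_comm] using h
    · have e1 := hammingDist_le_of_mem_reach (hZb x) hz
      have e2 := hammingDist_le_of_mem_reach (hZb y) hz'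
      have e3 := hammingDist_fl_le z (base x) a
      have e4 := hammingDist_fl_le z' (base y) (o y)
      have e5 := hammingDist_triangle (base y) (fl z' (o y)) (base x)
      rw [hammingDist_comm (base y) (fl z' (o y)), ← h] at e5
      rw [← h] at e4
      simp only [Set.mem_ofPred_eq]
      omega
  · rintro y -
    refine ncard_le_of_imp (q := fun a => a = o y ∨ ∃ z ∈ reach (Z x) (Λ x),
      ∃ z' ∈ reach (Z y) (Λ y), fl z a = fl z' (o y)) (ncard_or_le (ncard_eq_le_one _) ?_) ?_
    · refine (ncard_exists_mem_le _ fun z _ => ncard_exists_mem_le _ fun z' _ =>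
        ncard_fl_eq_le_one z _).trans ?_
      rw [mul_one]
      exact Nat.mul_le_mul (card_reach_le (hZc x) (hΛc x)) (card_reach_le (hZc y) (hΛc y))
    · rintro a ⟨-, ⟨-, h⟩ | h⟩
      · exact Or.inl h
      · exact Or.inr h

/-- The total number of items that clash with `x`, over all options of `x`, in terms of the
static bound `t` and a bound `K` on the crowding of the current choice. -/
lemma sum_clash_le (hZc : ∀ x, (Z x).card ≤ c) (hΛc : ∀ x, (Λ x).card ≤ c)
    (hZb : ∀ x, ∀ z ∈ Z x, hammingDist z (base x) ≤ r) (hR : 2 * r + 4 ≤ R)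
    (h1 : ∀ u, {x | u ∈ Z x}.ncard ≤ t)
    (h2 : ∀ w l, {x | hammingDist (base x) w ≤ R ∧ l ∈ Λ x}.ncard ≤ t)
    (o : ι → Fin d) {K : ℕ}
    (k1 : ∀ w l, {x | hammingDist (base x) w ≤ R ∧ o x = l}.ncard ≤ K)
    (k2 : ∀ u, {x | fl u (o x) ∈ reach (Z x) (Λ x)}.ncard ≤ K)
    (A : Finset (Fin d)) (x : ι) :
    ∑ a ∈ A, {y | y ≠ x ∧ Clash Z Λ x a y (o y)}.ncard ≤
      (c * (t + K) + c * (K + t)) * (1 + c + c * ((c + c * c) * 2)) := by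
  refine sum_ncard_le (Y := {y | (∃ z ∈ Z x, z ∈ Z y ∨ fl z (o y) ∈ reach (Z y) (Λ y)) ∨
    ∃ l ∈ Λ x, hammingDist (base y) (base x) ≤ R ∧ o y = l ∨
      hammingDist (base y) (base x) ≤ R ∧ l ∈ Λ y}) A _ ?_ ?_ ?_
  · refine ncard_or_le ?_ ?_
    · exact (ncard_exists_mem_le _ fun z _ => ncard_or_le (h1 z) (k2 z)).trans
        (Nat.mul_le_mul_right _ (hZc x))
    · exact (ncard_exists_mem_le _ fun l _ => ncard_or_le (k1 _ l) (h2 _ l)).trans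
        (Nat.mul_le_mul_right _ (hΛc x))
  · rintro a y ⟨-, w, l, h, h'⟩
    rcases conflict_cases h h' with ⟨-, hz⟩ | ⟨hl, z, hz, z', hz', h⟩
    · exact Or.inl hz
    · right
      have near : hammingDist (base y) (base x) ≤ R := by
        have e1 := hZb x z hz
        have e2 := hammingDist_le_of_mem_reach (hZb y) hz'
        have e3 := hammingDist_fl_le z (base x) a
        have e4 := hammingDist_fl_le z' (base y) (o y)
        rcases h with h | h
        · have e5 := hammingDist_triangle (base y) z' (base x)
          rw [hammingDist_comm (base y) z'] at e5
          rw [h] at e3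
          omega
        · have e5 := hammingDist_triangle (base y) (fl z' (o y)) (base x)
          rw [hammingDist_comm (base y) (fl z' (o y))] at e5
          rw [h] at e3
          omega
      rcases hl with hl | ⟨l, hl, hl'⟩
      · exact ⟨_, hl, Or.inl ⟨near, rfl⟩⟩
      · exact ⟨l, hl, Or.inr ⟨near, hl'⟩⟩
  · rintro y -
    refine ncard_le_of_imp (q := fun a => (a = o y ∨ a ∈ Λ y) ∨ ∃ z ∈ Z x,
      ∃ z' ∈ reach (Z y) (Λ y), fl z a = z' ∨ fl z a = fl z' (o y))
      (ncard_or_le (ncard_or_le (ncard_eq_le_one _) ?_) ?_) ?_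
    · rw [show {a | a ∈ Λ y} = (Λ y : Set (Fin d)) from rfl, Set.ncard_coe_finset]
      exact hΛc y
    · refine (ncard_exists_mem_le _ fun z _ => (ncard_exists_mem_le _ fun z' _ => ncard_or_le
        (ncard_fl_eq_le_one z _) (ncard_fl_eq_le_one z _)).trans
        (Nat.mul_le_mul_right _ (card_reach_le (hZc y) (hΛc y)))).trans ?_
      exact Nat.mul_le_mul_right _ (hZc x)
    · rintro a ⟨-, w, l, h, h'⟩
      rcases conflict_cases h h' with ⟨h, -⟩ | ⟨-, h⟩
      · exact Or.inl h
      · exact Or.inr h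

/-- **Balanced choice of disjoint gadgets.** If every item has at least `d / 2` options and the
items are locally sparse, then options can be chosen such that the resulting gadgets are pairwise
edge-disjoint, every option is chosen by few items close to a given vertex, and few items end up
at any given vertex.

A choice that minimizes a weighted number of crowding and clashing pairs does this: by local
optimality the cost of an item is at most its average cost over the options, and this average is
bounded by means of the largest cost itself, with a factor less than `1`. -/
theorem exists_disjoint_gadgets {A : ι → Finset (Fin d)}
    (hZc : ∀ x, (Z x).card ≤ c) (hΛc : ∀ x, (Λ x).card ≤ c)
    (hZb : ∀ x, ∀ z ∈ Z x, hammingDist z (base x) ≤ r) (hR : 2 * r + 4 ≤ R)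
    (h1 : ∀ u, {x | u ∈ Z x}.ncard ≤ t)
    (h2 : ∀ w l, {x | hammingDist (base x) w ≤ R ∧ l ∈ Λ x}.ncard ≤ t)
    (h3 : ∀ w, {x | hammingDist (base x) w ≤ 2 * R}.ncard ≤ t * d)
    (hA : ∀ x, d ≤ 2 * (A x).card)
    (hC1 : 1 + (c + c * c) * (c + c * c) ≤ C)
    (hC2 : 2 * c * (1 + c + c * ((c + c * c) * 2)) ≤ C) (hd : 24 * C ^ 2 * t < d) :
    ∃ o : ι → Fin d, (∀ x, o x ∈ A x) ∧
      (∀ x y, x ≠ y → ∀ w l, Gen (Z x) (Λ x) (o x) w l → ¬ Gen (Z y) (Λ y) (o y) w l) ∧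
      (∀ w l, {x | hammingDist (base x) w ≤ R ∧ o x = l}.ncard ≤ 7 * C * t) ∧
      ∀ u, {x | fl u (o x) ∈ reach (Z x) (Λ x)}.ncard ≤ 7 * C * t := by
  classical
  have hd0 : 0 < d := lt_of_le_of_lt (Nat.zero_le _) hd
  have hC0 : 1 ≤ C := le_trans (Nat.le_add_right _ _) hC1
  have hAne : ∀ x, (A x).Nonempty := fun x => by
    rw [← Finset.card_pos]; have := hA x; omega
  -- a clash weighs as much as linearly many crowding pairs
  let wt : ι → Fin d → ι → Fin d → ℕ := fun x a y b =>
    4 * C * (if Crowds R base Z Λ x a y b then 1 else 0) + d * (if Clash Z Λ x a y b then 1 else 0)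
  have hsymm : ∀ x a y b, wt x a y b = wt y b x a := by
    intro x a y b
    have e1 : Crowds R base Z Λ x a y b ↔ Crowds R base Z Λ y b x a := by
      unfold Crowds
      rw [hammingDist_comm, @eq_comm _ a b]
      refine or_congr_right ?_
      constructor <;> rintro ⟨z, hz, z', hz', h⟩ <;> exact ⟨z', hz', z, hz, h.symm⟩
    have e2 : Clash Z Λ x a y b ↔ Clash Z Λ y b x a := by
      constructor <;> rintro ⟨w, l, h, h'⟩ <;> exact ⟨w, l, h', h⟩
    simp only [wt, e1, e2]
  obtain ⟨o, hoA, hopt⟩ := exists_locally_optimal A hAne wt hsymm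
  let load : ι → Fin d → ℕ := fun x a => {y | y ≠ x ∧ Crowds R base Z Λ x a y (o y)}.ncard
  let conf : ι → Fin d → ℕ := fun x a => {y | y ≠ x ∧ Clash Z Λ x a y (o y)}.ncard
  have hcost : ∀ x a, ∑ y ∈ Finset.univ.erase x, wt x a y (o y) =
      4 * C * load x a + d * conf x a := by
    intro x a
    have aux : ∀ q : ι → Prop, {y | y ≠ x ∧ q y}.ncard =
        ∑ y ∈ Finset.univ.erase x, if q y then 1 else 0 := by
      intro q
      rw [Set.ncard_eq_toFinset_card', Finset.sum_boole, Nat.cast_id]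
      congr 1; ext y; simp
    simp only [wt, load, conf, aux, Finset.sum_add_distrib, Finset.mul_sum]
  simp only [hcost] at hopt
  obtain ⟨K', hK'⟩ : ∃ K', K' = Finset.univ.sup fun x => 4 * C * load x (o x) + d * conf x (o x) :=
    ⟨_, rfl⟩
  have hle : ∀ x, 4 * C * load x (o x) + d * conf x (o x) ≤ K' := fun x => by
    rw [hK']
    exact Finset.le_sup (f := fun x => 4 * C * load x (o x) + d * conf x (o x)) (Finset.mem_univ x)
  have hload : ∀ x, load x (o x) ≤ K' / (4 * C) := fun x => by
    rw [Nat.le_div_iff_mul_le (by omega), mul_comm]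
    have := hle x; omega
  -- pairwise crowding items form small sets
  have small : ∀ S : Set ι, (∀ x ∈ S, ∀ y ∈ S, y ≠ x → Crowds R base Z Λ x (o x) y (o y)) →
      S.ncard ≤ K' / (4 * C) + 1 := by
    intro S hS
    rcases S.eq_empty_or_nonempty with rfl | ⟨x, hx⟩
    · simp
    · have : S ⊆ insert x {y | y ≠ x ∧ Crowds R base Z Λ x (o x) y (o y)} := by
        intro y hy
        by_cases hyx : y = x
        · exact Or.inl hyx
        · exact Or.inr ⟨hyx, hS x hx y hy hyx⟩
      refine (Set.ncard_le_ncard this (Set.toFinite _)).trans ((Set.ncard_insert_le _ _).trans ?_)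
      exact Nat.succ_le_succ (hload x)
  have k1 : ∀ w l, {x | hammingDist (base x) w ≤ R ∧ o x = l}.ncard ≤ K' / (4 * C) + 1 := by
    intro w l
    refine small _ ?_
    rintro x ⟨hx, rfl⟩ y ⟨hy, hyx⟩ -
    refine Or.inl ⟨?_, hyx.symm⟩
    have := hammingDist_triangle (base x) w (base y)
    rw [hammingDist_comm w] at this
    omega
  have k2 : ∀ u, {x | fl u (o x) ∈ reach (Z x) (Λ x)}.ncard ≤ K' / (4 * C) + 1 := by
    intro u
    refine small _ ?_
    rintro x hx y hy -
    exact Or.inr ⟨_, hx, _, hy, by rw [fl_fl, fl_fl]⟩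
  obtain ⟨K, hK⟩ : ∃ K, K = K' / (4 * C) := ⟨_, rfl⟩
  rw [← hK] at k1 k2
  have hKK : 4 * C * K ≤ K' := by rw [hK]; exact Nat.mul_div_le _ _
  have bound : ∀ x, 4 * C * load x (o x) + d * conf x (o x) ≤
      8 * C * C * t + 2 * C * (t + K + 1) := by
    intro x
    have e1 := sum_crowds_le hZc hΛc hZb hR h3 o (A x) x
    have e2 := sum_clash_le hZc hΛc hZb hR h1 h2 o k1 k2 (A x) x
    have e1' : ∑ a ∈ A x, load x a ≤ t * d * C := e1.trans (Nat.mul_le_mul_left _ hC1)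
    have e2' : ∑ a ∈ A x, conf x a ≤ (t + K + 1) * C := by
      refine e2.trans ?_
      calc (c * (t + (K + 1)) + c * ((K + 1) + t)) * (1 + c + c * ((c + c * c) * 2))
          = (t + K + 1) * (2 * c * (1 + c + c * ((c + c * c) * 2))) := by ring
        _ ≤ _ := Nat.mul_le_mul_left _ hC2
    have e3 : (A x).card * (4 * C * load x (o x) + d * conf x (o x)) ≤
        4 * C * (t * d * C) + d * ((t + K + 1) * C) := by
      calc (A x).card * (4 * C * load x (o x) + d * conf x (o x))
          ≤ ∑ a ∈ A x, (4 * C * load x a + d * conf x a) := by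
            rw [← smul_eq_mul]
            exact Finset.card_nsmul_le_sum _ _ _ (hopt x)
        _ = 4 * C * ∑ a ∈ A x, load x a + d * ∑ a ∈ A x, conf x a := by
            rw [Finset.sum_add_distrib, Finset.mul_sum, Finset.mul_sum]
        _ ≤ _ := Nat.add_le_add (Nat.mul_le_mul_left _ e1') (Nat.mul_le_mul_left _ e2')
    refine Nat.le_of_mul_le_mul_left (?_ : d * _ ≤ d * _) hd0
    calc d * (4 * C * load x (o x) + d * conf x (o x))
        ≤ 2 * (A x).card * (4 * C * load x (o x) + d * conf x (o x)) :=
          Nat.mul_le_mul_right _ (hA x)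
      _ = 2 * ((A x).card * (4 * C * load x (o x) + d * conf x (o x))) := by ring
      _ ≤ 2 * (4 * C * (t * d * C) + d * ((t + K + 1) * C)) := Nat.mul_le_mul_left _ e3
      _ = d * (8 * C * C * t + 2 * C * (t + K + 1)) := by ring
  rcases isEmpty_or_nonempty ι with hι | ⟨⟨x₀⟩⟩
  · refine ⟨o, hoA, fun x => isEmptyElim x, fun w l => ?_, fun u => ?_⟩ <;>
    · rw [Set.eq_empty_of_isEmpty {x : ι | _}]; simp
  have ht : 1 ≤ t := by
    have e := h3 (base x₀)
    have : 1 ≤ {x | hammingDist (base x) (base x₀) ≤ 2 * R}.ncard := by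
      rw [Nat.one_le_iff_ne_zero, Ne, Set.ncard_eq_zero (Set.toFinite _)]
      exact Set.nonempty_iff_ne_empty.1 ⟨x₀, by simp⟩
    by_contra h0
    have : t = 0 := by omega
    subst this; omega
  -- the largest cost bounds itself, with the factor `1 / 2`
  have hK2 : K' ≤ 8 * C * C * t + 2 * C * (t + K + 1) := by
    rw [hK']; exact Finset.sup_le fun x _ => bound x
  have hCC : C * 1 ≤ C * C := Nat.mul_le_mul_left _ hC0
  have hCt : C * 1 ≤ C * t := Nat.mul_le_mul_left _ ht
  have hCCt : C * t * 1 ≤ C * t * C := Nat.mul_le_mul_left _ hC0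
  have hfin : K' ≤ 24 * C ^ 2 * t := by nlinarith
  have hconf : ∀ x, conf x (o x) = 0 := by
    intro x
    have := (Nat.le_add_left _ _).trans (hle x)
    by_contra h0
    have : d * 1 ≤ d * conf x (o x) := Nat.mul_le_mul_left _ (Nat.one_le_iff_ne_zero.2 h0)
    omega
  have hK7 : K + 1 ≤ 7 * C * t := by
    have : 4 * C * K ≤ 4 * C * (6 * C * t) := by nlinarith
    have := Nat.le_of_mul_le_mul_left this (by omega)
    nlinarith
  refine ⟨o, hoA, fun x y hxy w l hx hy => ?_, fun w l => (k1 w l).trans hK7,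
    fun u => (k2 u).trans hK7⟩
  have := hconf x
  simp only [conf] at this
  rw [Set.ncard_eq_zero (Set.toFinite _)] at this
  exact Set.eq_empty_iff_forall_notMem.1 this y ⟨hxy.symm, w, l, hx, hy⟩

end stage

end

/-! ### Locally sparse precolorings and bad edges -/

section

variable {d : ℕ}

/-- The sparsity conditions on a partial coloring `p` and forbidden lists `L`, with respect to
the standard coloring that colors every edge with its direction; `t` bounds all counts. The last
three conditions are those that depend on the standard coloring. -/
structure LocallySparse (t : ℕ) (p : (Fin d → Bool) → Fin d → Option (Fin d))
    (L : (Fin d → Bool) → Fin d → Finset (Fin d)) : Prop where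
  p_symm : ∀ v i, p (fl v i) i = p v i
  L_symm : ∀ v i, L (fl v i) i = L v i
  proper : ∀ v i i' c, p v i = some c → p v i' = some c → i = i'
  notMem : ∀ v i c, p v i = some c → c ∉ L v i
  deg : ∀ v, {i | p v i ≠ none}.ncard ≤ t
  color : ∀ w c, {x : (Fin d → Bool) × Fin d |
    hammingDist x.1 w ≤ 26 ∧ p x.1 x.2 = some c}.ncard ≤ t
  dir : ∀ w l, {v | hammingDist v w ≤ 26 ∧ p v l ≠ none}.ncard ≤ t
  list : ∀ v i, (L v i).card ≤ t
  list_deg : ∀ v c, {i | c ∈ L v i}.ncard ≤ t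
  list_dir : ∀ w l c, {v | hammingDist v w ≤ 26 ∧ c ∈ L v l}.ncard ≤ t
  diag : ∀ v, {i | i ∈ L v i}.ncard ≤ t
  diag_par : ∀ v l, {m | m ∈ L (fl v m) l}.ncard ≤ t
  wanted : ∀ v, {j | ∃ i, p (fl v j) i = some j}.ncard ≤ t

/-- The precolored edges whose color is not their direction. -/
def Wrong (p : (Fin d → Bool) → Fin d → Option (Fin d)) (v : Fin d → Bool) (i : Fin d) : Prop :=
  ∃ c, c ≠ i ∧ p v i = some c

/-- The edges whose direction is the prescribed color of an adjacent edge. -/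
def Wanted (p : (Fin d → Bool) → Fin d → Option (Fin d)) (v : Fin d → Bool) (j : Fin d) : Prop :=
  ∃ i, i ≠ j ∧ (p v i = some j ∨ p (fl v j) i = some j)

/-- The edges that have to give up their standard color, or whose standard color has to be made
available for an adjacent edge. -/
def Bad (p : (Fin d → Bool) → Fin d → Option (Fin d))
    (L : (Fin d → Bool) → Fin d → Finset (Fin d)) (v : Fin d → Bool) (i : Fin d) : Prop :=
  Wrong p v i ∨ Wanted p v i ∨ i ∈ L v i

/-- The conditions under which the color `i` of the edge `(v, i)` may be exchanged with `k` on the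
`4`-cycle through `v` in the directions `i` and `k`. -/
structure Avail (p : (Fin d → Bool) → Fin d → Option (Fin d))
    (L : (Fin d → Bool) → Fin d → Finset (Fin d)) (v : Fin d → Bool) (i k : Fin d) : Prop where
  ne : k ≠ i
  notMem : k ∉ L v i
  left : ¬ Bad p L v k ∧ p v k = none ∧ i ∉ L v k
  right : ¬ Bad p L (fl v i) k ∧ p (fl v i) k = none ∧ i ∉ L (fl v i) k
  opposite : ¬ Bad p L (fl v k) i ∧ p (fl v k) i = none ∧ k ∉ L (fl v k) i

section
variable {t : ℕ} {p : (Fin d → Bool) → Fin d → Option (Fin d)}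
  {L : (Fin d → Bool) → Fin d → Finset (Fin d)}

namespace LocallySparse

lemma wrong_flip (h : LocallySparse t p L) (v : Fin d → Bool) (i : Fin d) :
    Wrong p (fl v i) i ↔ Wrong p v i := by
  unfold Wrong; rw [h.p_symm]

lemma bad_flip (h : LocallySparse t p L) (v : Fin d → Bool) (i : Fin d) :
    Bad p L (fl v i) i ↔ Bad p L v i := by
  unfold Bad Wanted
  rw [h.wrong_flip, h.L_symm, fl_fl]
  simp only [or_comm]

lemma bad_deg (h : LocallySparse t p L) (v : Fin d → Bool) : {i | Bad p L v i}.ncard ≤ 4 * t := by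
  have e : {j | Wanted p v j}.ncard ≤ t + t := by
    refine ncard_le_of_imp (q := fun j => (∃ i, p v i = some j) ∨ ∃ i, p (fl v j) i = some j)
      (ncard_or_le ?_ (h.wanted v)) ?_
    · refine ncard_le_of_inj_rel (fun j i => p v i = some j) (h.deg v) ?_ ?_
      · rintro i - a - b - hab hb
        exact Option.some.inj (hab.symm.trans hb)
      · rintro j ⟨i, hi⟩
        exact ⟨i, by simp [Set.mem_ofPred_eq, hi], hi⟩
    · rintro j ⟨i, -, h1 | h1⟩
      · exact Or.inl ⟨i, h1⟩
      · exact Or.inr ⟨i, h1⟩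
  have := ncard_or_le (ncard_le_of_imp (h.deg v) (p := fun i => Wrong p v i) (by
    rintro i ⟨c, -, hc⟩; simp [hc])) (ncard_or_le e (h.diag v))
  refine this.trans (by omega)

/-- The radius is one less than in the assumptions, because a wanted edge is found from a
precolored edge at one of its endpoints. -/
lemma bad_dir (h : LocallySparse t p L) (w : Fin d → Bool) (l : Fin d) :
    {v | hammingDist v w ≤ 25 ∧ Bad p L v l}.ncard ≤ 4 * t := by
  have e1 : {v | hammingDist v w ≤ 25 ∧ ∃ i, p v i = some l}.ncard ≤ t := by
    refine ncard_le_of_inj_rel (fun v x => x.1 = v) (h.color w l) ?_ ?_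
    · rintro x - a - b - rfl rfl; rfl
    · rintro v ⟨hv, i, hi⟩
      exact ⟨(v, i), ⟨by simp only; omega, hi⟩, rfl⟩
  have e2 : {v | hammingDist v w ≤ 25 ∧ ∃ i, p (fl v l) i = some l}.ncard ≤ t := by
    refine ncard_le_of_inj_rel (fun v x => x.1 = fl v l) (h.color w l) ?_ ?_
    · rintro x - a - b - ha hb
      exact fl_inj_left.1 (ha.symm.trans hb)
    · rintro v ⟨hv, i, hi⟩
      have := hammingDist_fl_le v w l
      exact ⟨(fl v l, i), ⟨by simp only; omega, hi⟩, rfl⟩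
  refine (ncard_le_of_imp (ncard_or_le (h.dir w l) (ncard_or_le (ncard_or_le e1 e2)
    (h.list_dir w l l))) ?_).trans (by omega : _ ≤ 4 * t)
  rintro v ⟨hv, ⟨c, -, hc⟩ | ⟨i, -, h1 | h1⟩ | h1⟩
  · exact Or.inl ⟨by omega, by simp [hc]⟩
  · exact Or.inr (Or.inl (Or.inl ⟨hv, i, h1⟩))
  · exact Or.inr (Or.inl (Or.inr ⟨hv, i, h1⟩))
  · exact Or.inr (Or.inr ⟨by omega, h1⟩)

/-- Conditions on parallel edges: a bounded number of the edges `(z + m, l)` of direction `l`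
satisfy a property that is rare among the edges of direction `l` close to `z`. -/
lemma ncard_parallel_le {q : (Fin d → Bool) → Prop} {z : Fin d → Bool} {n k : ℕ} (hn : 1 ≤ n)
    (hq : {v | hammingDist v z ≤ n ∧ q v}.ncard ≤ k) : {m | q (fl z m)}.ncard ≤ k := by
  refine ncard_le_of_inj_rel (fun m v => v = fl z m) hq ?_ ?_
  · rintro x - a - b - ha hb
    exact fl_inj_right.1 (ha.symm.trans hb)
  · rintro m hm
    refine ⟨_, ⟨?_, hm⟩, rfl⟩
    rw [hammingDist_fl_self]; exact hn

lemma exists_avail (h : LocallySparse t p L) (hd : 2 + 40 * t ≤ d) (v : Fin d → Bool)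
    (i : Fin d) : ∃ A : Finset (Fin d), (∀ k ∈ A, Avail p L v i k) ∧ d ≤ 2 * A.card := by
  classical
  refine ⟨Finset.univ.filter fun k => Avail p L v i k, by simp, ?_⟩
  have hbad : {k | ¬ Avail p L v i k}.ncard ≤ 1 + 20 * t := by
    have b : ∀ u, {k | Bad p L u k ∨ p u k ≠ none ∨ i ∈ L u k}.ncard ≤ 4 * t + (t + t) := fun u =>
      ncard_or_le (h.bad_deg u) (ncard_or_le (h.deg u) (h.list_deg u i))
    have o : {k | Bad p L (fl v k) i ∨ p (fl v k) i ≠ none ∨ k ∈ L (fl v k) i}.ncard ≤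
        4 * t + (t + t) :=
      ncard_or_le (ncard_parallel_le (q := fun u => Bad p L u i) (by norm_num) (h.bad_dir v i))
        (ncard_or_le (ncard_parallel_le (q := fun u => p u i ≠ none) (by norm_num) (h.dir v i))
          (h.diag_par v i))
    have l : {k | k ∈ L v i}.ncard ≤ t := by
      rw [show {k | k ∈ L v i} = (L v i : Set (Fin d)) from rfl, Set.ncard_coe_finset]
      exact h.list v i
    refine (ncard_le_of_imp (ncard_or_le (ncard_eq_le_one i) (ncard_or_le l
      (ncard_or_le (b v) (ncard_or_le (b (fl v i)) o)))) ?_).trans (by omega)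
    intro k hk
    by_contra hcon
    push Not at hcon
    exact hk ⟨hcon.1, hcon.2.1, hcon.2.2.1, hcon.2.2.2.1, hcon.2.2.2.2⟩
  have hsum := Finset.card_filter_add_card_filter_not (s := (Finset.univ : Finset (Fin d)))
    (fun k => Avail p L v i k)
  rw [Set.ncard_eq_toFinset_card'] at hbad
  have e : ({k | ¬ Avail p L v i k} : Set (Fin d)).toFinset =
      Finset.univ.filter fun k => ¬ Avail p L v i k := by ext; simp
  rw [e] at hbad
  simp only [Finset.card_univ, Fintype.card_fin] at hsum
  omega

lemma avail_flip (h : LocallySparse t p L) {v : Fin d → Bool} {i k : Fin d}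
    (ha : Avail p L v i k) : Avail p L (fl v i) i k := by
  refine ⟨ha.ne, ?_, ha.right, ?_, ?_⟩
  · rw [h.L_symm]; exact ha.notMem
  · rw [fl_fl]; exact ha.left
  · rw [fl_comm, h.bad_flip, h.p_symm, h.L_symm]; exact ha.opposite

/-- The edges of a `4`-cycle other than the bad edge that it is chosen for. -/
lemma gen_of_avail (h : LocallySparse t p L) {v : Fin d → Bool} {i k : Fin d}
    (ha : Avail p L v i k) {w : Fin d → Bool} {l : Fin d}
    (hg : Gen {v, fl v i} {i} k w l) :
    ¬ Bad p L w l ∧ p w l = none ∧ (l = k → i ∉ L w l) ∧ (l = i → k ∉ L w l) := by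
  have hne := ha.ne
  rcases hg with ⟨rfl, hw⟩ | ⟨hl, hw⟩
  · have key : ∀ u, u ∈ ({v, fl v i} : Finset (Fin d → Bool)) →
        ¬ Bad p L u l ∧ p u l = none ∧ i ∉ L u l := by
      intro u hu
      simp only [Finset.mem_insert, Finset.mem_singleton] at hu
      rcases hu with rfl | rfl
      · exact ha.left
      · exact ha.right
    have : ¬ Bad p L w l ∧ p w l = none ∧ i ∉ L w l := by
      rcases hw with hw | hw
      · exact key _ hw
      · have := key _ hw
        rwa [h.bad_flip, h.p_symm, h.L_symm] at this
    exact ⟨this.1, this.2.1, fun _ => this.2.2, fun e => absurd e hne⟩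
  · obtain rfl : l = i := by simpa using hl
    have hw' : w = fl v k ∨ w = fl (fl v k) l := by
      simp only [Finset.mem_insert, Finset.mem_singleton, fl_eq_iff] at hw
      rw [fl_comm v k l]
      rcases hw with (hw | hw) | hw | hw
      · exact Or.inl hw
      · exact Or.inr hw
      · exact Or.inr (by rw [hw, fl_comm])
      · left; rw [hw, fl_fl]
    have : ¬ Bad p L w l ∧ p w l = none ∧ k ∉ L w l := by
      rcases hw' with rfl | rfl
      · exact ha.opposite
      · rw [h.bad_flip, h.p_symm, h.L_symm]; exact ha.opposite
    exact ⟨this.1, this.2.1, fun e => absurd e.symm hne, fun _ => this.2.2⟩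

end LocallySparse

end

end

/-! ### The first stage -/

section

variable {d : ℕ}

/-- The result of the first stage: a proper coloring `f` that avoids all lists and arises from the
standard coloring by exchanging the colors on disjoint `4`-cycles, one through each bad edge
`(v, i)`, its second direction being `κ v i`. The predicate `U` describes the edges on these
`4`-cycles, and `T` bounds how often such edges occur locally. -/
structure FirstStage (T : ℕ) (p : (Fin d → Bool) → Fin d → Option (Fin d))
    (L : (Fin d → Bool) → Fin d → Finset (Fin d)) (κ f : (Fin d → Bool) → Fin d → Fin d)
    (U : (Fin d → Bool) → Fin d → Prop) : Prop where
  proper : IsProper f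
  κ_symm : ∀ v i, κ (fl v i) i = κ v i
  f_bad : ∀ v i, Bad p L v i → f v i = κ v i
  f_κ : ∀ v i, Bad p L v i → f v (κ v i) = i
  not_bad_κ : ∀ v i, Bad p L v i → ¬ Bad p L v (κ v i)
  p_κ : ∀ v i, Bad p L v i → p v (κ v i) = none
  U_flip : ∀ w l, U w l → U (fl w l) l
  U_bad : ∀ v i, Bad p L v i → U v i
  U_κ : ∀ v i, Bad p L v i → U v (κ v i)
  f_std : ∀ w l, ¬ U w l → f w l = l
  U_uncolored : ∀ w l, U w l → Bad p L w l ∨ p w l = none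
  f_notMem : ∀ w l, f w l ∉ L w l
  distinct : ∀ v i w i', Bad p L v i → Bad p L w i' → κ v i = κ w i' →
    (w = v ∨ w = fl v (κ v i)) → w = v ∧ i = i'
  U_deg : ∀ z, {m | U z m}.ncard ≤ T
  U_par : ∀ z l, {m | U (fl z m) l}.ncard ≤ T
  near : ∀ w l, {x : (Fin d → Bool) × Fin d |
    hammingDist x.1 w ≤ 11 ∧ Bad p L x.1 x.2 ∧ κ x.1 x.2 = l}.ncard ≤ T
  far : ∀ u, {x : (Fin d → Bool) × Fin d |
    Bad p L x.1 x.2 ∧ fl x.1 (κ x.1 x.2) = u}.ncard ≤ T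

/-- The endpoint of the edge `(v, i)` whose `i`-th coordinate is `false`. -/
def bot (v : Fin d → Bool) (i : Fin d) : Fin d → Bool := if v i then fl v i else v

lemma bot_apply (v : Fin d → Bool) (i : Fin d) : bot v i i = false := by
  unfold bot; by_cases h : v i <;> simp [h]

lemma bot_cases (v : Fin d → Bool) (i : Fin d) : v = bot v i ∨ v = fl (bot v i) i := by
  unfold bot; by_cases h : v i <;> simp [h]

lemma bot_flip (v : Fin d → Bool) (i : Fin d) : bot (fl v i) i = bot v i := by
  unfold bot; by_cases h : v i <;> simp [h]

lemma bot_of_false {v : Fin d → Bool} {i : Fin d} (h : v i = false) : bot v i = v := by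
  simp [bot, h]

lemma bot_eq_of_cases {u v : Fin d → Bool} {i : Fin d} (hv : v i = false)
    (h : u = v ∨ u = fl v i) : v = bot u i := by
  rcases h with rfl | rfl
  · rw [bot_of_false hv]
  · rw [bot_flip, bot_of_false hv]

section
variable {t : ℕ} {p : (Fin d → Bool) → Fin d → Option (Fin d)}
  {L : (Fin d → Bool) → Fin d → Finset (Fin d)}

/-- A set of edges, each represented by its lower endpoint and its direction. -/
abbrev Items (q : (Fin d → Bool) → Fin d → Prop) : Type :=
  {x : (Fin d → Bool) × Fin d // q x.1 x.2 ∧ x.1 x.2 = false}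

lemma Items.ext_of_dir {q : (Fin d → Bool) → Fin d → Prop} {x y : Items q} {u : Fin d → Bool}
    {i : Fin d} (hx : x.1.2 = i) (hy : y.1.2 = i) (hxu : u = x.1.1 ∨ u = fl x.1.1 i)
    (hyu : u = y.1.1 ∨ u = fl y.1.1 i) : x = y := by
  obtain ⟨⟨v, j⟩, hv, hv'⟩ := x
  obtain ⟨⟨w, j'⟩, hw, hw'⟩ := y
  simp only at hx hy hxu hyu hv' hw'
  subst hx hy
  have : v = w := (bot_eq_of_cases hv' hxu).trans (bot_eq_of_cases hw' hyu).symm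
  subst this; rfl

lemma Items.exists_of {q : (Fin d → Bool) → Fin d → Prop} (hq : ∀ v i, q (fl v i) i ↔ q v i)
    {v : Fin d → Bool} {i : Fin d} (h : q v i) :
    ∃ x : Items q, x.1.2 = i ∧ (v = x.1.1 ∨ v = fl x.1.1 i) := by
  have hb : q (bot v i) i := by
    rcases bot_cases v i with e | e
    · rwa [← e]
    · rw [← hq, ← e]; exact h
  exact ⟨⟨(bot v i, i), hb, bot_apply v i⟩, rfl, bot_cases v i⟩

/-- Items close to `w` whose direction is `l`. -/
lemma Items.ncard_dir_le {q : (Fin d → Bool) → Fin d → Prop} {w : Fin d → Bool} {l : Fin d}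
    {n k : ℕ} (h : {v | hammingDist v w ≤ n ∧ q v l}.ncard ≤ k) :
    {x : Items q | hammingDist x.1.1 w ≤ n ∧ x.1.2 = l}.ncard ≤ k := by
  refine ncard_le_of_inj_rel (fun x v => x.1.1 = v) h ?_ ?_
  · rintro v - x ⟨-, hx⟩ y ⟨-, hy⟩ hxv hyv
    exact Items.ext_of_dir hx hy (Or.inl hxv.symm) (Or.inl hyv.symm)
  · rintro x ⟨hx, rfl⟩
    exact ⟨_, ⟨hx, x.2.1⟩, rfl⟩

lemma Items.ncard_near_le {q : (Fin d → Bool) → Fin d → Prop} {w : Fin d → Bool}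
    {n k : ℕ} (h : ∀ l, {v | hammingDist v w ≤ n ∧ q v l}.ncard ≤ k) :
    {x : Items q | hammingDist x.1.1 w ≤ n}.ncard ≤ k * d := by
  rw [mul_comm]
  refine ncard_le_mul_of_rel (T := (Set.univ : Set (Fin d))) (fun x l => x.1.2 = l) ?_ ?_ ?_
  · rw [Set.ncard_univ, Nat.card_eq_fintype_card, Fintype.card_fin]
  · intro l _
    exact Items.ncard_dir_le (h l)
  · intro x _
    exact ⟨_, Set.mem_univ _, rfl⟩

lemma mem_reach_pair {v z : Fin d → Bool} {i : Fin d} (h : fl z i ∈ ({v, fl v i} : Finset _)) :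
    z ∈ ({v, fl v i} : Finset _) := by
  simp only [Finset.mem_insert, Finset.mem_singleton, fl_eq_iff, fl_fl] at h ⊢
  tauto

/-- The coloring that exchanges the colors on one `4`-cycle for every bad edge. -/
lemma LocallySparse.exists_recoloring (h : LocallySparse t p L) (o : Items (Bad p L) → Fin d)
    (ho : ∀ x, Avail p L x.1.1 x.1.2 (o x))
    (hdis : ∀ x y : Items (Bad p L), x ≠ y → ∀ w l, Gen {x.1.1, fl x.1.1 x.1.2} {x.1.2} (o x) w l →
      ¬ Gen {y.1.1, fl y.1.1 y.1.2} {y.1.2} (o y) w l) :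
    ∃ f, IsProper f ∧
      (∀ (x : Items (Bad p L)) (v : Fin d → Bool), v = x.1.1 ∨ v = fl x.1.1 x.1.2 →
        f v x.1.2 = o x ∧ f v (o x) = x.1.2) ∧
      (∀ w l, ¬ Bad p L w l →
        (∀ x : Items (Bad p L), ¬ Gen {x.1.1, fl x.1.1 x.1.2} {x.1.2} (o x) w l) → f w l = l) ∧
      ∀ w l, f w l ∉ L w l := by
  have hid : IsProper (fun (_ : Fin d → Bool) (l : Fin d) => l) :=
    ⟨fun _ _ => rfl, fun _ _ _ h => h⟩
  let F : Items (Bad p L) → (Fin d → Bool) → Fin d → Fin d :=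
    fun x => sq (fun _ l => l) x.1.1 x.1.2 (o x)
  have hF : ∀ x, IsProper (F x) := fun x => hid.sq rfl rfl
  have hdiff : ∀ x w l, F x w l = l ∨ (SameEdge w l x.1.1 x.1.2 ∧ F x w l = o x) ∨
      (Gen {x.1.1, fl x.1.1 x.1.2} {x.1.2} (o x) w l ∧
        (l = x.1.2 ∧ F x w l = o x ∨ l = o x ∧ F x w l = x.1.2)) := by
    intro x w l
    rcases hid.sq_cases (v := x.1.1) (a := x.1.2) (b := o x) rfl rfl w l with e | ⟨hs, e⟩
    · exact Or.inl e
    · right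
      rcases e with ⟨rfl, e⟩ | ⟨rfl, e⟩
      · rcases inSq_iff.1 hs with hw | hw | hw | hw
        · exact Or.inl ⟨⟨rfl, Or.inl hw⟩, e⟩
        · exact Or.inl ⟨⟨rfl, Or.inr hw⟩, e⟩
        · exact Or.inr ⟨Or.inr ⟨by simp, Or.inl (by simp [hw])⟩, Or.inl ⟨rfl, e⟩⟩
        · exact Or.inr ⟨Or.inr ⟨by simp, Or.inl (by simp [hw])⟩, Or.inl ⟨rfl, e⟩⟩
      · refine Or.inr ⟨Or.inl ⟨rfl, ?_⟩, Or.inr ⟨rfl, e⟩⟩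
        rcases inSq_iff.1 hs with hw | hw | hw | hw <;> simp [hw]
  have hFdis : ∀ x y, x ≠ y → ∀ w l, F x w l ≠ l → F y w l = l := by
    intro x y hxy w l hx
    by_contra hy
    rcases (hdiff x w l).resolve_left hx with ⟨⟨hl, hw⟩, -⟩ | ⟨hx, -⟩ <;>
      rcases (hdiff y w l).resolve_left hy with ⟨⟨hl', hw'⟩, -⟩ | ⟨hy, -⟩
    · rw [← hl] at hw; rw [← hl'] at hw'
      exact hxy (Items.ext_of_dir hl.symm hl'.symm hw hw')
    · refine (h.gen_of_avail (ho y) hy).1 ?_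
      rcases hw with rfl | rfl
      · rw [hl]; exact x.2.1
      · rw [hl, h.bad_flip]; exact x.2.1
    · refine (h.gen_of_avail (ho x) hx).1 ?_
      rcases hw' with rfl | rfl
      · rw [hl']; exact y.2.1
      · rw [hl', h.bad_flip]; exact y.2.1
    · exact hdis x y hxy w l hx hy
  obtain ⟨f, hf, hf1, hf2⟩ := exists_merge hid hF hFdis
  have hvalue : ∀ (x : Items (Bad p L)) (v : Fin d → Bool), v = x.1.1 ∨ v = fl x.1.1 x.1.2 →
      f v x.1.2 = o x ∧ f v (o x) = x.1.2 := by
    intro x v hv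
    have hs : InSq x.1.1 x.1.2 (o x) v := by
      rw [inSq_iff]; tauto
    have e1 : F x v x.1.2 = o x := sq_left hs
    have e2 : F x v (o x) = x.1.2 := sq_right hs
    refine ⟨?_, ?_⟩
    · rw [hf1 x, e1]; rw [e1]; exact (ho x).ne
    · rw [hf1 x, e2]; rw [e2]; exact (ho x).ne.symm
  have hstd : ∀ w l, ¬ Bad p L w l →
      (∀ x : Items (Bad p L), ¬ Gen {x.1.1, fl x.1.1 x.1.2} {x.1.2} (o x) w l) → f w l = l := by
    intro w l hb hg
    refine hf2 w l fun x => ?_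
    rcases hdiff x w l with e | ⟨⟨hl, hw⟩, -⟩ | ⟨e, -⟩
    · exact e
    · exfalso
      refine hb ?_
      rcases hw with rfl | rfl
      · rw [hl]; exact x.2.1
      · rw [hl, h.bad_flip]; exact x.2.1
    · exact absurd e (hg x)
  refine ⟨f, hf, hvalue, hstd, fun w l => ?_⟩
  by_cases hb : Bad p L w l
  · obtain ⟨x, hx, hw⟩ := Items.exists_of h.bad_flip hb
    subst hx
    rw [(hvalue x w hw).1]
    have := (ho x).notMem
    rcases hw with hw | hw
    · rwa [hw]
    · rwa [hw, h.L_symm]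
  · by_cases hg : ∃ x, F x w l ≠ l
    · obtain ⟨x, hx⟩ := hg
      rw [hf1 x w l hx]
      rcases (hdiff x w l).resolve_left hx with ⟨⟨hl, hw⟩, -⟩ | ⟨hg, e⟩
      · exfalso
        refine hb ?_
        rcases hw with rfl | rfl
        · rw [hl]; exact x.2.1
        · rw [hl, h.bad_flip]; exact x.2.1
      · have := h.gen_of_avail (ho x) hg
        rcases e with ⟨hl, e⟩ | ⟨hl, e⟩
        · rw [e]; exact this.2.2.2 hl
        · rw [e]; exact this.2.2.1 hl
    · push Not at hg
      rw [hf2 w l hg]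
      exact fun hl => hb (Or.inr (Or.inr hl))

/-- The first stage can be carried out. -/
lemma LocallySparse.exists_firstStage (h : LocallySparse t p L)
    (hd : 2 + 2000000 * t ≤ d) : ∃ κ f U, FirstStage (30000 * t) p L κ f U := by
  classical
  choose A hA hAd using h.exists_avail (by omega : 2 + 40 * t ≤ d)
  have hdir : ∀ n ≤ 25, ∀ w l, {v | hammingDist v w ≤ n ∧ Bad p L v l}.ncard ≤ 4 * t :=
    fun n hn w l => ncard_le_of_imp (h.bad_dir w l) fun v hv => ⟨hv.1.trans hn, hv.2⟩
  have hs1 : ∀ u, {x : Items (Bad p L) |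
      u ∈ ({x.1.1, fl x.1.1 x.1.2} : Finset _)}.ncard ≤ 4 * t := by
    intro u
    refine ncard_le_of_inj_rel (fun x i => x.1.2 = i) (h.bad_deg u) ?_ ?_
    · rintro i - x hx y hy rfl hyi
      simp only [Set.mem_ofPred_eq, Finset.mem_insert, Finset.mem_singleton] at hx hy
      exact Items.ext_of_dir rfl hyi hx (by rwa [hyi] at hy)
    · rintro x hx
      refine ⟨_, ?_, rfl⟩
      simp only [Set.mem_ofPred_eq, Finset.mem_insert, Finset.mem_singleton] at hx ⊢
      rcases hx with rfl | rfl
      · exact x.2.1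
      · rw [h.bad_flip]; exact x.2.1
  have hs2 : ∀ w l, {x : Items (Bad p L) | hammingDist x.1.1 w ≤ 12 ∧
      l ∈ ({x.1.2} : Finset _)}.ncard ≤ 4 * t := by
    intro w l
    refine ncard_le_of_imp (Items.ncard_dir_le (hdir 12 (by norm_num) w l)) ?_
    rintro x ⟨hx, hl⟩
    exact ⟨hx, (Finset.mem_singleton.1 hl).symm⟩
  -- `108` is the constant that `exists_disjoint_gadgets` requires for `c = 2`
  obtain ⟨o, hoA, hdis, hcap1, hcap2⟩ := exists_disjoint_gadgets (ι := Items (Bad p L))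
    (c := 2) (t := 4 * t) (r := 1) (R := 12) (C := 108) (base := fun x => x.1.1)
    (Z := fun x => {x.1.1, fl x.1.1 x.1.2}) (Λ := fun x => {x.1.2})
    (A := fun x => A x.1.1 x.1.2) (fun x => Finset.card_le_two) (fun x => by simp)
    (by
      intro x z hz
      simp only [Finset.mem_insert, Finset.mem_singleton] at hz
      rcases hz with rfl | rfl
      · simp
      · rw [hammingDist_fl_self]) (by norm_num) hs1 hs2
    (fun w => Items.ncard_near_le (hdir 24 (by norm_num) w)) (fun x => hAd _ _) (by norm_num)
    (by norm_num) (by omega)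
  have ho : ∀ x, Avail p L x.1.1 x.1.2 (o x) := fun x => hA _ _ _ (hoA x)
  obtain ⟨f, hf, hfx, hstd, hL⟩ := h.exists_recoloring o ho hdis
  let κ : (Fin d → Bool) → Fin d → Fin d := fun v i =>
    if hb : Bad p L (bot v i) i then o ⟨(bot v i, i), hb, bot_apply v i⟩ else i
  -- every bad edge is an item
  have item : ∀ v i, Bad p L v i → ∃ x : Items (Bad p L), x.1.2 = i ∧
      (v = x.1.1 ∨ v = fl x.1.1 i) ∧ κ v i = o x := by
    intro v i hb
    have hb' : Bad p L (bot v i) i := by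
      rcases bot_cases v i with e | e
      · rwa [← e]
      · rw [← h.bad_flip, ← e]; exact hb
    exact ⟨⟨(bot v i, i), hb', bot_apply v i⟩, rfl, bot_cases v i, by simp only [κ, hb', dite_true]⟩
  have avail : ∀ v i, Bad p L v i → Avail p L v i (κ v i) := by
    intro v i hb
    obtain ⟨x, rfl, hv, hκ⟩ := item v i hb
    rw [hκ]
    rcases hv with hv | hv
    · rw [hv]; exact ho x
    · rw [hv]; exact h.avail_flip (ho x)
  let U : (Fin d → Bool) → Fin d → Prop := fun w l => Bad p L w l ∨
    ∃ x : Items (Bad p L), Gen {x.1.1, fl x.1.1 x.1.2} {x.1.2} (o x) w l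
  have memZ : ∀ (x : Items (Bad p L)) v, v = x.1.1 ∨ v = fl x.1.1 x.1.2 →
      v ∈ ({x.1.1, fl x.1.1 x.1.2} : Finset _) := by
    intro x v hv; simpa using hv
  refine ⟨κ, f, U, ⟨hf, ?_, ?_, ?_, fun v i hb => (avail v i hb).left.1,
    fun v i hb => (avail v i hb).left.2.1, ?_, fun v i hb => Or.inl hb, ?_, ?_, ?_, hL, ?_, ?_, ?_,
    ?_, ?_⟩⟩
  · intro v i
    simp only [κ, bot_flip]
  · intro v i hb
    obtain ⟨x, rfl, hv, hκ⟩ := item v i hb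
    rw [hκ]; exact (hfx x v hv).1
  · intro v i hb
    obtain ⟨x, rfl, hv, hκ⟩ := item v i hb
    rw [hκ]; exact (hfx x v hv).2
  · rintro w l (hb | ⟨x, hx⟩)
    · exact Or.inl ((h.bad_flip w l).2 hb)
    · exact Or.inr ⟨x, hx.flip⟩
  · intro v i hb
    obtain ⟨x, rfl, hv, hκ⟩ := item v i hb
    exact Or.inr ⟨x, Or.inl ⟨hκ, Or.inl (memZ x v hv)⟩⟩
  · intro w l hU
    simp only [U, not_or, not_exists] at hU
    exact hstd w l hU.1 hU.2
  · rintro w l (hb | ⟨x, hx⟩)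
    · exact Or.inl hb
    · exact Or.inr (h.gen_of_avail (ho x) hx).2.1
  · intro v i w i' hb hb' hκ hw
    have hne := (avail v i hb).ne
    obtain ⟨x, rfl, hv, hx⟩ := item v i hb
    obtain ⟨y, rfl, hv', hy⟩ := item w i' hb'
    by_cases hxy : x = y
    · subst hxy
      refine ⟨?_, rfl⟩
      rcases hw with hw | hw
      · exact hw
      · exfalso
        have hw' : w = v ∨ w = fl v x.1.2 := by
          rcases hv with e | e <;> rcases hv' with e' | e' <;> simp [e, e']
        rcases hw' with e | e
        · exact fl_ne v _ (hw.symm.trans e)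
        · exact hne (fl_inj_right.1 (hw.symm.trans e))
    · exfalso
      refine hdis x y hxy v (κ v x.1.2) (Or.inl ⟨hx, Or.inl (memZ x v hv)⟩)
        (Or.inl ⟨hκ.trans hy, ?_⟩)
      rcases hw with rfl | hw
      · exact Or.inl (memZ y _ hv')
      · right
        rw [← hy, ← hκ, ← hw]
        exact memZ y w hv'
  · intro z
    refine (ncard_or_le (h.bad_deg z) (k := 4 * t) (l := (4 * t + 7 * 108 * (4 * t)) * 2)
      ?_).trans (by omega)
    refine ncard_le_mul_of_rel (fun m x => m = o x ∨ m = x.1.2)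
      (ncard_or_le (hs1 z) (hcap2 z)) ?_ ?_
    · intro x _
      exact ncard_le_of_imp (ncard_or_le (ncard_eq_le_one (o x)) (ncard_eq_le_one x.1.2))
        fun a ha => ha.2
    · rintro m ⟨x, ⟨rfl, hz | hz⟩ | ⟨hm, hz⟩⟩
      · exact ⟨x, Or.inl hz, Or.inl rfl⟩
      · exact ⟨x, Or.inr (subset_reach hz), Or.inl rfl⟩
      · obtain rfl := Finset.mem_singleton.1 hm
        refine ⟨x, Or.inr (subset_reach ?_), Or.inr rfl⟩
        rcases hz with hz | hz
        · exact hz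
        · exact mem_reach_pair hz
  · intro z l
    refine (ncard_or_le (LocallySparse.ncard_parallel_le (q := fun u => Bad p L u l) (n := 25)
      (by norm_num) (h.bad_dir z l)) (k := 4 * t)
      (l := (7 * 108 * (4 * t) + 4 * t) * 4) ?_).trans (by omega)
    refine ncard_le_mul_of_rel (fun m x => ∃ z' ∈ ({x.1.1, fl x.1.1 x.1.2} : Finset _),
      fl z m = z' ∨ fl z m = fl z' (o x)) (ncard_or_le (hcap1 z l) (hs2 z l)) ?_ ?_
    · intro x _
      refine (ncard_le_of_imp (ncard_exists_mem_le _ fun z' _ => ncard_or_le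
        (ncard_fl_eq_le_one z z') (ncard_fl_eq_le_one z (fl z' (o x)))) fun a ha => ha.2).trans ?_
      exact Nat.mul_le_mul_right 2 Finset.card_le_two
    · rintro m ⟨x, hx⟩
      have near : ∀ z' ∈ ({x.1.1, fl x.1.1 x.1.2} : Finset _),
          fl z m = z' ∨ fl z m = fl z' (o x) → hammingDist x.1.1 z ≤ 12 := by
        intro z' hz' hm
        have e1 : hammingDist z' x.1.1 ≤ 1 := by
          simp only [Finset.mem_insert, Finset.mem_singleton] at hz'
          rcases hz' with rfl | rfl
          · simp
          · rw [hammingDist_fl_self]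
        have e2 := hammingDist_fl_le z' x.1.1 (o x)
        have e3 := hammingDist_le_fl z x.1.1 m
        rw [hammingDist_comm]
        rcases hm with hm | hm <;> rw [hm] at e3 <;> omega
      rcases hx with ⟨rfl, hz⟩ | ⟨hl, hz⟩
      · obtain ⟨z', hz', hm⟩ : ∃ z' ∈ ({x.1.1, fl x.1.1 x.1.2} : Finset _),
            fl z m = z' ∨ fl z m = fl z' (o x) := by
          rcases hz with hz | hz
          · exact ⟨_, hz, Or.inl rfl⟩
          · exact ⟨_, hz, Or.inr (by rw [fl_fl])⟩
        exact ⟨x, Or.inl ⟨near z' hz' hm, rfl⟩, z', hz', hm⟩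
      · obtain rfl := Finset.mem_singleton.1 hl
        have hz : fl (fl z m) (o x) ∈ ({x.1.1, fl x.1.1 x.1.2} : Finset _) := by
          rcases hz with hz | hz
          · exact hz
          · exact mem_reach_pair hz
        exact ⟨x, Or.inr ⟨near _ hz (Or.inr (by rw [fl_fl])), hl⟩, _, hz, Or.inr (by rw [fl_fl])⟩
  · intro w l
    refine (ncard_le_mul_of_rel (k := 7 * 108 * (4 * t)) (n := 2)
      (fun (x : (Fin d → Bool) × Fin d) (y : Items (Bad p L)) => y.1.2 = x.2 ∧
        (x.1 = y.1.1 ∨ x.1 = fl y.1.1 x.2)) (hcap1 w l) ?_ ?_).trans (by omega)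
    · intro y _
      refine (ncard_le_of_imp (ncard_or_le (ncard_eq_le_one (y.1.1, y.1.2))
        (ncard_eq_le_one (fl y.1.1 y.1.2, y.1.2))) ?_)
      rintro ⟨v, i⟩ ⟨-, e, hv⟩
      simp only at e hv
      subst e
      rcases hv with rfl | rfl
      · exact Or.inl rfl
      · exact Or.inr rfl
    · rintro ⟨v, i⟩ ⟨hvw, hb, hl⟩
      simp only at hvw hb hl
      obtain ⟨x, hx, hv, hκ⟩ := item v i hb
      refine ⟨x, ⟨?_, hκ.symm.trans hl⟩, hx, hv⟩
      have e := hammingDist_le_fl x.1.1 w i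
      rcases hv with hv | hv
      · rw [← hv]; omega
      · rw [← hv] at e; omega
  · intro u
    refine (ncard_le_mul_of_rel (k := 7 * 108 * (4 * t)) (n := 2)
      (fun (x : (Fin d → Bool) × Fin d) (y : Items (Bad p L)) => y.1.2 = x.2 ∧
        (x.1 = y.1.1 ∨ x.1 = fl y.1.1 x.2)) (hcap2 u) ?_ ?_).trans (by omega)
    · intro y _
      refine (ncard_le_of_imp (ncard_or_le (ncard_eq_le_one (y.1.1, y.1.2))
        (ncard_eq_le_one (fl y.1.1 y.1.2, y.1.2))) ?_)
      rintro ⟨v, i⟩ ⟨-, e, hv⟩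
      simp only at e hv
      subst e
      rcases hv with rfl | rfl
      · exact Or.inl rfl
      · exact Or.inr rfl
    · rintro ⟨v, i⟩ ⟨hb, hu⟩
      simp only at hb hu
      obtain ⟨x, hx, hv, hκ⟩ := item v i hb
      refine ⟨x, subset_reach ?_, hx, hv⟩
      rw [← hu, ← hκ, fl_fl]
      subst hx
      exact memZ x v hv

end

end

/-! ### The gadget of the second stage -/

section

variable {d : ℕ}

lemma not_inSq {v w : Fin d → Bool} {a b : Fin d} (x : Fin d) (ha : x ≠ a) (hb : x ≠ b)
    (h : w x ≠ v x) : ¬ InSq v a b w := fun hs => h (hs x ha hb)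

lemma gen_of_inSq_fl {v w : Fin d → Bool} {a b m l : Fin d} {Z : Finset (Fin d → Bool)}
    {Λ : Finset (Fin d)} (hv : v ∈ Z) (ha : fl v a ∈ Z) (hb : fl v b ∈ Z) (ha' : a ∈ Λ)
    (hb' : b ∈ Λ) (hs : InSq (fl v m) a b w) (hl : l = a ∨ l = b) : Gen Z Λ m w l := by
  refine Or.inr ⟨by rcases hl with rfl | rfl <;> assumption, ?_⟩
  rcases inSq_iff.1 hs with rfl | rfl | rfl | rfl
  · left; simpa using hv
  · left; rw [fl_comm _ a, fl_fl]; exact ha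
  · left; rw [fl_comm _ b, fl_fl]; exact hb
  · right
    rw [fl_comm v m a, fl_comm _ m b, fl_fl]
    rcases hl with rfl | rfl
    · rw [fl_comm, fl_fl]; exact hb
    · rw [fl_fl]; exact ha

lemma gen_of_inSq {v w : Fin d → Bool} {a m l : Fin d} {Z : Finset (Fin d → Bool)}
    {Λ : Finset (Fin d)} (hv : v ∈ Z) (ha : fl v a ∈ Z) (ha' : a ∈ Λ)
    (hs : InSq v a m w) (hl : l = a ∨ l = m) : SameEdge w l v a ∨ Gen Z Λ m w l := by
  rcases hl with rfl | rfl
  · rcases inSq_iff.1 hs with rfl | rfl | rfl | rfl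
    · exact Or.inl ⟨rfl, Or.inl rfl⟩
    · exact Or.inl ⟨rfl, Or.inr rfl⟩
    · exact Or.inr (Or.inr ⟨ha', Or.inl (by rwa [fl_fl])⟩)
    · exact Or.inr (Or.inr ⟨ha', Or.inl (by rwa [fl_fl])⟩)
  · right
    refine Or.inl ⟨rfl, ?_⟩
    rcases inSq_iff.1 hs with rfl | rfl | rfl | rfl
    · exact Or.inl hv
    · exact Or.inl ha
    · right; rwa [fl_fl]
    · right; rwa [fl_fl]

/-- The second kind of gadget. The edge `(v, i)` has color `k`, and color `j` is found at its
endpoints `v` and `v'` on the edges `(v, p)` and `(v', q)`. If a free direction `m` is such that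
the surrounding edges have the standard color, then six exchanges on `4`-cycles move color `j`
to direction `m` at both endpoints and then to the edge `(v, i)`. -/
lemma IsProper.exists_gadget {f : (Fin d → Bool) → Fin d → Fin d} (hf : IsProper f)
    {v : Fin d → Bool} {i j k p q m : Fin d} {Z : Finset (Fin d → Bool)} {Λ : Finset (Fin d)}
    (hij : i ≠ j) (hip : i ≠ p) (hiq : i ≠ q) (hjk : j ≠ k)
    (hkp : k ≠ p) (hkq : k ≠ q)
    (hΛ : ∀ l, l = i ∨ l = j ∨ l = k ∨ l = p ∨ l = q → l ∈ Λ) (hm : m ∉ Λ)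
    (hZ : ∀ u, u = v ∨ u = fl v p ∨ u = fl v j ∨ u = fl v k ∨ u = fl v i ∨
      u = fl (fl v i) q ∨ u = fl (fl v i) j → u ∈ Z)
    (hi : f v i = k) (hp : f v p = j) (hq : f (fl v i) q = j)
    (hstd : ∀ w l, Gen Z Λ m w l → f w l = l) :
    ∃ g, IsProper g ∧ g v i = j ∧ ∀ w l, g w l = f w l ∨ (SameEdge w l v i ∧ g w l = j) ∨
      (SameEdge w l v p ∧ g w l = m) ∨ (SameEdge w l (fl v i) q ∧ g w l = m) ∨
      (Gen Z Λ m w l ∧ g w l ∈ Λ) ∨ (Gen Z Λ m w l ∧ g w l = m) := by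
  have li : i ∈ Λ := hΛ _ (by simp)
  have lj : j ∈ Λ := hΛ _ (by simp)
  have lk : k ∈ Λ := hΛ _ (by simp)
  have lp : p ∈ Λ := hΛ _ (by simp)
  have lq : q ∈ Λ := hΛ _ (by simp)
  have hmi : m ≠ i := fun h => hm (h ▸ li)
  have hmj : m ≠ j := fun h => hm (h ▸ lj)
  have hmk : m ≠ k := fun h => hm (h ▸ lk)
  have hmp : m ≠ p := fun h => hm (h ▸ lp)
  have hmq : m ≠ q := fun h => hm (h ▸ lq)
  have zv : v ∈ Z := hZ _ (by simp)
  have zp : fl v p ∈ Z := hZ _ (by simp)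
  have zj : fl v j ∈ Z := hZ _ (by simp)
  have zk : fl v k ∈ Z := hZ _ (by simp)
  have zi : fl v i ∈ Z := hZ _ (by simp)
  have zq' : fl (fl v i) q ∈ Z := hZ _ (by simp)
  have zj' : fl (fl v i) j ∈ Z := hZ _ (by simp)
  have std : ∀ u ∈ Z, f u m = m := fun u hu => hstd u m (Or.inl ⟨rfl, Or.inl hu⟩)
  have stdL : ∀ u ∈ Z, ∀ l ∈ Λ, f (fl u m) l = l := fun u hu l hl =>
    hstd _ _ (Or.inr ⟨hl, Or.inl (by rwa [fl_fl])⟩)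
  -- the vertices on opposite sides in direction `i` or `m`
  have nm : ∀ {a b : Fin d} (u : Fin d → Bool), m ≠ a → m ≠ b → ¬ InSq (fl u m) a b u :=
    fun u ha hb => not_inSq m ha hb (by simp)
  have ni : ∀ {a b : Fin d} (u w : Fin d → Bool), i ≠ a → i ≠ b → u i = w i →
      ¬ InSq (fl u i) a b w := fun u w ha hb h => not_inSq i ha hb (by simp [h])
  -- the exchange at `(v + m; j, p)`
  have b1 : f (fl (fl v m) j) p = p := by rw [fl_comm]; exact stdL _ zj _ lp
  have b2 : f (fl (fl v m) p) j = j := by rw [fl_comm]; exact stdL _ zp _ lj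
  have hg1 := hf.sq (v := fl v m) (a := j) (b := p) (by rw [b1, stdL _ zv _ lp])
    (by rw [b2, stdL _ zv _ lj])
  have c1 := hf.sq_cases (v := fl v m) (a := j) (b := p) (by rw [b1, stdL _ zv _ lp])
    (by rw [b2, stdL _ zv _ lj])
  rw [stdL _ zv _ lp, stdL _ zv _ lj] at c1
  obtain ⟨g1, eg1⟩ : ∃ g, g = HypercubeColoring.sq f (fl v m) j p := ⟨_, rfl⟩
  rw [← eg1] at hg1 c1
  have g1i : ∀ w l, w i = !v i → g1 w l = f w l := fun w l h => by
    rw [eg1, sq_of_not_inSq]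
    exact not_inSq i hij hip (by rw [h, fl_of_ne _ hmi.symm]; simp)
  have g1v : ∀ l, g1 v l = f v l := fun l => by
    rw [eg1, sq_of_not_inSq (nm v hmj hmp)]
  have g1ne : ∀ w l, l ≠ j → l ≠ p → g1 w l = f w l := fun w l h1 h2 => by
    rw [eg1, sq_of_ne _ h1 h2]
  have g1p : g1 (fl v m) p = j := by
    rw [eg1, sq_right (inSq_self _ _ _), stdL _ zv _ lj]
  -- the exchange at `(v' + m; j, q)`
  have b1 : g1 (fl (fl (fl v i) m) j) q = q := by
    rw [g1i _ _ (by rw [fl_of_ne _ hij, fl_of_ne _ hmi.symm, fl_same]), fl_comm]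
    exact stdL _ zj' _ lq
  have b2 : g1 (fl (fl (fl v i) m) q) j = j := by
    rw [g1i _ _ (by rw [fl_of_ne _ hiq, fl_of_ne _ hmi.symm, fl_same]), fl_comm]
    exact stdL _ zq' _ lj
  have b3 : ∀ l ∈ Λ, g1 (fl (fl v i) m) l = l := fun l hl => by
    rw [g1i _ _ (by rw [fl_of_ne _ hmi.symm, fl_same])]
    exact stdL _ zi _ hl
  have hg2 := hg1.sq (v := fl (fl v i) m) (a := j) (b := q) (by rw [b1, b3 _ lq])
    (by rw [b2, b3 _ lj])
  have c2 := hg1.sq_cases (v := fl (fl v i) m) (a := j) (b := q) (by rw [b1, b3 _ lq])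
    (by rw [b2, b3 _ lj])
  rw [b3 _ lq, b3 _ lj] at c2
  obtain ⟨g2, eg2⟩ : ∃ g, g = HypercubeColoring.sq g1 (fl (fl v i) m) j q := ⟨_, rfl⟩
  rw [← eg2] at hg2 c2
  have g2i : ∀ w l, w i = v i → g2 w l = g1 w l := fun w l h => by
    rw [eg2, sq_of_not_inSq]
    exact not_inSq i hij hiq (by rw [h, fl_of_ne _ hmi.symm]; simp)
  have g2v : ∀ l, g2 v l = f v l := fun l => by rw [g2i _ _ rfl, g1v]
  have g2v' : ∀ l, g2 (fl v i) l = f (fl v i) l := fun l => by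
    rw [eg2, sq_of_not_inSq (nm _ hmj hmq), g1i _ _ (fl_same _ _)]
  have g2ne : ∀ w l, l ≠ j → l ≠ p → l ≠ q → g2 w l = f w l := fun w l h1 h2 h3 => by
    rw [eg2, sq_of_ne _ h1 h3, g1ne _ _ h1 h2]
  have g2p : g2 (fl v m) p = j := by rw [g2i _ _ (fl_of_ne _ hmi.symm), g1p]
  have g2q : g2 (fl (fl v i) m) q = j := by
    rw [eg2, sq_right (inSq_self _ _ _), b3 _ lj]
  -- the exchange at `(v + m; i, k)`
  have b1 : g2 (fl (fl v m) i) k = k := by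
    rw [g2ne _ _ hjk.symm hkp hkq, fl_comm]; exact stdL _ zi _ lk
  have b2 : g2 (fl (fl v m) k) i = i := by
    rw [g2ne _ _ hij hip hiq, fl_comm]; exact stdL _ zk _ li
  have b3 : g2 (fl v m) k = k := by rw [g2ne _ _ hjk.symm hkp hkq]; exact stdL _ zv _ lk
  have b4 : g2 (fl v m) i = i := by rw [g2ne _ _ hij hip hiq]; exact stdL _ zv _ li
  have hg3 := hg2.sq (v := fl v m) (a := i) (b := k) (by rw [b1, b3]) (by rw [b2, b4])
  have c3 := hg2.sq_cases (v := fl v m) (a := i) (b := k) (by rw [b1, b3]) (by rw [b2, b4])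
  rw [b3, b4] at c3
  obtain ⟨g3, eg3⟩ : ∃ g, g = HypercubeColoring.sq g2 (fl v m) i k := ⟨_, rfl⟩
  rw [← eg3] at hg3 c3
  have g3ne : ∀ w l, l ≠ i → l ≠ k → g3 w l = g2 w l := fun w l h1 h2 => by
    rw [eg3, sq_of_ne _ h1 h2]
  have g3m : ∀ u ∈ Z, g3 u m = m := fun u hu => by
    rw [g3ne _ _ hmi hmk, g2ne _ _ hmj hmp hmq, std u hu]
  have g3vi : g3 v i = k := by
    rw [eg3, sq_of_not_inSq (nm _ hmi hmk), g2v, hi]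
  have g3i : g3 (fl v m) i = k := by rw [eg3, sq_left (inSq_self _ _ _), b3]
  have g3p : g3 v p = j := by rw [g3ne _ _ hip.symm hkp.symm, g2v, hp]
  -- the exchange at `(v; p, m)`
  have b1 : g3 (fl v m) p = j := by rw [g3ne _ _ hip.symm hkp.symm, g2p]
  have hg4 := hg3.sq (v := v) (a := p) (b := m) (by rw [g3m _ zp, g3m _ zv]) (by rw [b1, g3p])
  have c4 := hg3.sq_cases (v := v) (a := p) (b := m) (by rw [g3m _ zp, g3m _ zv])
    (by rw [b1, g3p])
  rw [g3m _ zv, g3p] at c4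
  obtain ⟨g4, eg4⟩ : ∃ g, g = HypercubeColoring.sq g3 v p m := ⟨_, rfl⟩
  rw [← eg4] at hg4 c4
  have g4i : ∀ w l, w i = !v i → g4 w l = g3 w l := fun w l h => by
    rw [eg4, sq_of_not_inSq]
    exact not_inSq i hip hmi.symm (by rw [h]; simp)
  have g4ne : ∀ w l, l ≠ p → l ≠ m → g4 w l = g3 w l := fun w l h1 h2 => by
    rw [eg4, sq_of_ne _ h1 h2]
  have g4m : g4 v m = j := by rw [eg4, sq_right (inSq_self _ _ _), g3p]
  -- the exchange at `(v'; q, m)`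
  have b1 : g4 (fl (fl v i) q) m = m := by
    rw [g4i _ _ (by rw [fl_of_ne _ hiq, fl_same]), g3m _ zq']
  have b2 : g4 (fl v i) m = m := by rw [g4i _ _ (fl_same _ _), g3m _ zi]
  have b3 : g4 (fl (fl v i) m) q = j := by
    rw [g4i _ _ (by rw [fl_of_ne _ hmi.symm, fl_same]), g3ne _ _ hiq.symm hkq.symm, g2q]
  have b4 : g4 (fl v i) q = j := by
    rw [g4i _ _ (fl_same _ _), g3ne _ _ hiq.symm hkq.symm, g2v', hq]
  have hg5 := hg4.sq (v := fl v i) (a := q) (b := m) (by rw [b1, b2]) (by rw [b3, b4])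
  have c5 := hg4.sq_cases (v := fl v i) (a := q) (b := m) (by rw [b1, b2]) (by rw [b3, b4])
  rw [b2, b4] at c5
  obtain ⟨g5, eg5⟩ : ∃ g, g = HypercubeColoring.sq g4 (fl v i) q m := ⟨_, rfl⟩
  rw [← eg5] at hg5 c5
  have g5m' : g5 (fl v i) m = j := by rw [eg5, sq_right (inSq_self _ _ _), b4]
  have g5m : g5 v m = j := by
    rw [eg5, sq_of_not_inSq (ni v v hiq hmi.symm rfl), g4m]
  have g5ne : ∀ w, g5 w i = g3 w i := fun w => by
    rw [eg5, sq_of_ne _ hiq hmi.symm, g4ne _ _ hip hmi.symm]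
  -- the exchange at `(v; i, m)`
  have hg6 := hg5.sq (v := v) (a := i) (b := m) (by rw [g5m', g5m])
    (by rw [g5ne, g5ne, g3i, g3vi])
  have c6 := hg5.sq_cases (v := v) (a := i) (b := m) (by rw [g5m', g5m])
    (by rw [g5ne, g5ne, g3i, g3vi])
  rw [g5m, g5ne, g3vi] at c6
  refine ⟨_, hg6, by rw [sq_left (inSq_self _ _ _), g5m], fun w l => ?_⟩
  rcases c6 w l with e | ⟨hs, e⟩
  swap
  · rcases gen_of_inSq (l := l) zv zi li hs (e.imp And.left And.left) with hl | hl
    · rcases e with e | e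
      · exact Or.inr (Or.inl ⟨hl, e.2⟩)
      · exact absurd (e.1.symm.trans hl.1) hmi
    · rcases e with e | e <;> rw [e.2] <;> simp [hl, lj, lk]
  rw [e]
  rcases c5 w l with e | ⟨hs, e⟩
  swap
  · rcases gen_of_inSq (l := l) zi zq' lq hs (e.imp And.left And.left) with hl | hl
    · rcases e with e | e
      · exact Or.inr (Or.inr (Or.inr (Or.inl ⟨hl, e.2⟩)))
      · exact absurd (e.1.symm.trans hl.1) hmq
    · rcases e with e | e <;> rw [e.2] <;> simp [hl, lj]
  rw [e]
  rcases c4 w l with e | ⟨hs, e⟩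
  swap
  · rcases gen_of_inSq (l := l) zv zp lp hs (e.imp And.left And.left) with hl | hl
    · rcases e with e | e
      · exact Or.inr (Or.inr (Or.inl ⟨hl, e.2⟩))
      · exact absurd (e.1.symm.trans hl.1) hmp
    · rcases e with e | e <;> rw [e.2] <;> simp [hl, lj]
  rw [e]
  rcases c3 w l with e | ⟨hs, e⟩
  swap
  · have hl := gen_of_inSq_fl (l := l) zv zi zk li lk hs (e.imp And.left And.left)
    rcases e with e | e <;> rw [e.2] <;> simp [hl, li, lk]
  rw [e]
  rcases c2 w l with e | ⟨hs, e⟩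
  swap
  · have hl := gen_of_inSq_fl (l := l) zi zj' zq' lj lq hs (e.imp And.left And.left)
    rcases e with e | e <;> rw [e.2] <;> simp [hl, lj, lq]
  rw [e]
  rcases c1 w l with e | ⟨hs, e⟩
  · exact Or.inl e
  · have hl := gen_of_inSq_fl (l := l) zv zj zp lj lp hs (e.imp And.left And.left)
    rcases e with e | e <;> rw [e.2] <;> simp [hl, lj, lp]

end

/-! ### The second stage -/

section

variable {d : ℕ}

/-- The prescribed color of a precolored edge; the junk value for other edges is the direction. -/
def target (p : (Fin d → Bool) → Fin d → Option (Fin d)) (v : Fin d → Bool) (i : Fin d) : Fin d :=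
  (p v i).getD i

/-- The vertices next to the endpoint `u` of a wrong edge `(u, i)` that matter for its gadget. -/
def endZ (p : (Fin d → Bool) → Fin d → Option (Fin d)) (κ : (Fin d → Bool) → Fin d → Fin d)
    (u : Fin d → Bool) (i : Fin d) : Finset (Fin d → Bool) :=
  {u, fl u (κ u (target p u i)), fl u (target p u i), fl u (κ u i)}

open Classical in
/-- The vertices that matter for the gadget of a wrong edge. -/
noncomputable def gadgetZ (p : (Fin d → Bool) → Fin d → Option (Fin d))
    (κ : (Fin d → Bool) → Fin d → Fin d) (x : Items (Wrong p)) : Finset (Fin d → Bool) :=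
  endZ p κ x.1.1 x.1.2 ∪ endZ p κ (fl x.1.1 x.1.2) x.1.2

/-- The directions that are determined by a wrong edge and occur in its gadget. -/
def gadgetΛ (p : (Fin d → Bool) → Fin d → Option (Fin d)) (κ : (Fin d → Bool) → Fin d → Fin d)
    (x : Items (Wrong p)) : Finset (Fin d) :=
  {x.1.2, target p x.1.1 x.1.2, κ x.1.1 x.1.2, κ x.1.1 (target p x.1.1 x.1.2),
    κ (fl x.1.1 x.1.2) (target p x.1.1 x.1.2)}

lemma Gen.induct {Z : Finset (Fin d → Bool)} {Λ : Finset (Fin d)} {m : Fin d}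
    {q : (Fin d → Bool) → Fin d → Prop} (h1 : ∀ z ∈ Z, q z m)
    (h2 : ∀ z ∈ Z, ∀ l ∈ Λ, q (fl z m) l) (hq : ∀ w l, q (fl w l) l → q w l)
    {w : Fin d → Bool} {l : Fin d} (h : Gen Z Λ m w l) : q w l := by
  rcases h with ⟨rfl, h | h⟩ | ⟨hl, h | h⟩
  · exact h1 _ h
  · exact hq _ _ (h1 _ h)
  · have := h2 _ h l hl
    rwa [fl_fl] at this
  · have := h2 _ h l hl
    rw [fl_comm _ l m, fl_fl] at this
    exact hq _ _ this

lemma card_endZ_le (p : (Fin d → Bool) → Fin d → Option (Fin d))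
    (κ : (Fin d → Bool) → Fin d → Fin d) (u : Fin d → Bool) (i : Fin d) :
    (endZ p κ u i).card ≤ 4 := Finset.card_le_four

lemma card_gadgetZ_le (p : (Fin d → Bool) → Fin d → Option (Fin d))
    (κ : (Fin d → Bool) → Fin d → Fin d) (x : Items (Wrong p)) : (gadgetZ p κ x).card ≤ 8 :=
  (Finset.card_union_le _ _).trans (Nat.add_le_add (card_endZ_le _ _ _ _) (card_endZ_le _ _ _ _))

lemma card_gadgetΛ_le (p : (Fin d → Bool) → Fin d → Option (Fin d))
    (κ : (Fin d → Bool) → Fin d → Fin d) (x : Items (Wrong p)) : (gadgetΛ p κ x).card ≤ 5 :=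
  Finset.card_le_five

section
variable {t T : ℕ} {p : (Fin d → Bool) → Fin d → Option (Fin d)}
  {L : (Fin d → Bool) → Fin d → Finset (Fin d)} {κ f : (Fin d → Bool) → Fin d → Fin d}
  {U : (Fin d → Bool) → Fin d → Prop}

lemma Wrong.target {v : Fin d → Bool} {i : Fin d} (h : Wrong p v i) :
    p v i = some (target p v i) ∧ target p v i ≠ i := by
  obtain ⟨c, hc, e⟩ := h
  simp [HypercubeColoring.target, e, hc]

lemma Wrong.bad {v : Fin d → Bool} {i : Fin d} (h : Wrong p v i) : Bad p L v i := Or.inl h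

lemma Wrong.bad_target {v : Fin d → Bool} {i : Fin d} (h : Wrong p v i) :
    Bad p L v (HypercubeColoring.target p v i) :=
  Or.inr (Or.inl ⟨i, h.target.2.symm, Or.inl h.target.1⟩)

lemma LocallySparse.target_flip (h : LocallySparse t p L) (v : Fin d → Bool) (i : Fin d) :
    target p (fl v i) i = target p v i := by
  unfold target; rw [h.p_symm]

/-- A wrong edge is determined by an endpoint and its prescribed color. -/
lemma LocallySparse.eq_of_target (h : LocallySparse t p L) {v : Fin d → Bool} {i i' : Fin d}
    (hi : Wrong p v i) (hi' : Wrong p v i') (e : target p v i = target p v i') : i = i' :=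
  h.proper v i i' _ hi.target.1 (by rw [e]; exact hi'.target.1)

/-- Few gadgets of wrong edges involve a given vertex. -/
lemma FirstStage.ncard_mem_gadgetZ_le (hs : FirstStage T p L κ f U) (h : LocallySparse t p L)
    (u : Fin d → Bool) : {x : Items (Wrong p) | u ∈ gadgetZ p κ x}.ncard ≤ 2 * t + 2 * T := by
  have e1 : {y : (Fin d → Bool) × Fin d | Wrong p y.1 y.2 ∧ y.1 = u}.ncard ≤ t := by
    refine ncard_le_of_inj_rel (fun y i => y.2 = i) (h.deg u) ?_ ?_
    · rintro i - a ⟨-, ha⟩ b ⟨-, hb⟩ ha' hb'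
      exact Prod.ext (ha.trans hb.symm) (ha'.trans hb'.symm)
    · rintro y ⟨hy, rfl⟩
      exact ⟨y.2, by simp [hy.target.1], rfl⟩
  have e2 : {y : (Fin d → Bool) × Fin d | Wrong p y.1 y.2 ∧
      fl y.1 (κ y.1 (target p y.1 y.2)) = u}.ncard ≤ T := by
    refine ncard_le_of_inj_rel (fun y x => x = (y.1, target p y.1 y.2)) (hs.far u) ?_ ?_
    · rintro x - ⟨v, i⟩ ⟨ha, -⟩ ⟨w, i'⟩ ⟨hb, -⟩ rfl e
      simp only [Prod.mk.injEq] at e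
      obtain ⟨rfl, e⟩ := e
      obtain rfl := h.eq_of_target ha hb e
      rfl
    · rintro y ⟨hy, rfl⟩
      exact ⟨_, ⟨hy.bad_target, rfl⟩, rfl⟩
  have e3 : {y : (Fin d → Bool) × Fin d | Wrong p y.1 y.2 ∧
      fl y.1 (target p y.1 y.2) = u}.ncard ≤ t := by
    refine ncard_le_of_inj_rel (fun y j => j = target p y.1 y.2) (h.wanted u) ?_ ?_
    · rintro j - ⟨v, i⟩ ⟨ha, ha'⟩ ⟨w, i'⟩ ⟨hb, hb'⟩ rfl e
      simp only at e ha' hb'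
      rw [← hb', ← e] at ha'
      obtain rfl := fl_inj_left.1 ha'
      obtain rfl := h.eq_of_target ha hb e
      rfl
    · rintro y ⟨hy, rfl⟩
      refine ⟨_, ⟨y.2, ?_⟩, rfl⟩
      rw [fl_fl]; exact hy.target.1
  have e4 : {y : (Fin d → Bool) × Fin d | Wrong p y.1 y.2 ∧ fl y.1 (κ y.1 y.2) = u}.ncard ≤ T :=
    ncard_le_of_imp (hs.far u) fun y hy => ⟨hy.1.bad, hy.2⟩
  have e5 : {y : (Fin d → Bool) × Fin d | Wrong p y.1 y.2 ∧ u ∈ endZ p κ y.1 y.2}.ncard ≤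
      2 * t + 2 * T := by
    refine (ncard_le_of_imp (ncard_or_le e1 (ncard_or_le e2 (ncard_or_le e3 e4))) ?_).trans
      (by omega)
    rintro y ⟨hy, hu⟩
    simp only [endZ, Finset.mem_insert, Finset.mem_singleton] at hu
    rcases hu with hu | hu | hu | hu
    · exact Or.inl ⟨hy, hu.symm⟩
    · exact Or.inr (Or.inl ⟨hy, hu.symm⟩)
    · exact Or.inr (Or.inr (Or.inl ⟨hy, hu.symm⟩))
    · exact Or.inr (Or.inr (Or.inr ⟨hy, hu.symm⟩))
  refine ncard_le_of_inj_rel (fun x y => x.1.2 = y.2 ∧ (y.1 = x.1.1 ∨ y.1 = fl x.1.1 y.2)) e5 ?_ ?_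
  · rintro y - a - b - ⟨ha, ha'⟩ ⟨hb, hb'⟩
    exact Items.ext_of_dir ha hb ha' hb'
  · rintro x hx
    have hx : u ∈ gadgetZ p κ x := hx
    rcases Finset.mem_union.1 hx with hx | hx
    · exact ⟨(x.1.1, x.1.2), ⟨x.2.1, hx⟩, rfl, Or.inl rfl⟩
    · exact ⟨(fl x.1.1 x.1.2, x.1.2), ⟨(h.wrong_flip _ _).2 x.2.1, hx⟩, rfl, Or.inr rfl⟩

lemma LocallySparse.wrong_dir (h : LocallySparse t p L) {n : ℕ} (hn : n ≤ 26)
    (w : Fin d → Bool) (l : Fin d) : {v | hammingDist v w ≤ n ∧ Wrong p v l}.ncard ≤ t :=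
  ncard_le_of_imp (h.dir w l) fun v hv => ⟨hv.1.trans hn, by simp [hv.2.target.1]⟩

/-- Few gadgets of wrong edges close to a given vertex involve a given direction. -/
lemma FirstStage.ncard_mem_gadgetΛ_le (hs : FirstStage T p L κ f U) (h : LocallySparse t p L)
    (w : Fin d → Bool) (l : Fin d) : {x : Items (Wrong p) | hammingDist x.1.1 w ≤ 8 ∧
      l ∈ gadgetΛ p κ x}.ncard ≤ 2 * t + 3 * T := by
  have e1 := Items.ncard_dir_le (h.wrong_dir (n := 8) (by norm_num) w l)
  have e2 : {x : Items (Wrong p) | hammingDist x.1.1 w ≤ 8 ∧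
      target p x.1.1 x.1.2 = l}.ncard ≤ t := by
    refine ncard_le_of_inj_rel (fun x y => x.1 = y) (h.color w l) ?_ ?_
    · rintro y - a - b - rfl e
      exact Subtype.ext e.symm
    · rintro x ⟨hx, rfl⟩
      exact ⟨_, ⟨by omega, x.2.1.target.1⟩, rfl⟩
  have e3 : {x : Items (Wrong p) | hammingDist x.1.1 w ≤ 8 ∧ κ x.1.1 x.1.2 = l}.ncard ≤ T := by
    refine ncard_le_of_inj_rel (fun x y => x.1 = y) (hs.near w l) ?_ ?_
    · rintro y - a - b - rfl e
      exact Subtype.ext e.symm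
    · rintro x ⟨hx, rfl⟩
      exact ⟨_, ⟨by omega, x.2.1.bad, rfl⟩, rfl⟩
  have e4 : {x : Items (Wrong p) | hammingDist x.1.1 w ≤ 8 ∧
      κ x.1.1 (target p x.1.1 x.1.2) = l}.ncard ≤ T := by
    refine ncard_le_of_inj_rel (fun x y => y = (x.1.1, target p x.1.1 x.1.2)) (hs.near w l) ?_ ?_
    · rintro y - ⟨⟨v, i⟩, hv, hv'⟩ - ⟨⟨v', i'⟩, hw, hw'⟩ - rfl e
      simp only [Prod.mk.injEq] at e
      obtain ⟨rfl, e⟩ := e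
      obtain rfl := h.eq_of_target hv hw e
      rfl
    · rintro x ⟨hx, rfl⟩
      exact ⟨_, ⟨by simp only; omega, x.2.1.bad_target, rfl⟩, rfl⟩
  have e5 : {x : Items (Wrong p) | hammingDist x.1.1 w ≤ 8 ∧
      κ (fl x.1.1 x.1.2) (target p x.1.1 x.1.2) = l}.ncard ≤ T := by
    refine ncard_le_of_inj_rel (fun x y => y = (fl x.1.1 x.1.2, target p x.1.1 x.1.2))
      (hs.near w l) ?_ ?_
    · rintro y - ⟨⟨v, i⟩, hv, hv'⟩ - ⟨⟨v', i'⟩, hw, hw'⟩ - rfl e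
      simp only [Prod.mk.injEq] at e hv hw
      obtain ⟨e', e⟩ := e
      have hv2 := (h.wrong_flip v i).2 hv
      have hw2 := (h.wrong_flip v' i').2 hw
      rw [← h.target_flip v i, ← h.target_flip v' i'] at e
      rw [← e'] at hw2 e
      obtain rfl := h.eq_of_target hv2 hw2 e
      obtain rfl := fl_inj_left.1 e'
      rfl
    · rintro x ⟨hx, rfl⟩
      have e := hammingDist_fl_le x.1.1 w x.1.2
      refine ⟨_, ⟨by simp only; omega, ?_, rfl⟩, rfl⟩
      have := ((h.wrong_flip _ _).2 x.2.1).bad_target (L := L)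
      rwa [h.target_flip] at this
  refine (ncard_le_of_imp (ncard_or_le e1 (ncard_or_le e2 (ncard_or_le e3
    (ncard_or_le e4 e5)))) ?_).trans (by omega)
  rintro x ⟨hx, hl⟩
  simp only [gadgetΛ, Finset.mem_insert, Finset.mem_singleton] at hl
  rcases hl with hl | hl | hl | hl | hl
  · exact Or.inl ⟨hx, hl.symm⟩
  · exact Or.inr (Or.inl ⟨hx, hl.symm⟩)
  · exact Or.inr (Or.inr (Or.inl ⟨hx, hl.symm⟩))
  · exact Or.inr (Or.inr (Or.inr (Or.inl ⟨hx, hl.symm⟩)))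
  · exact Or.inr (Or.inr (Or.inr (Or.inr ⟨hx, hl.symm⟩)))

lemma hammingDist_le_of_mem_gadgetZ (x : Items (Wrong p)) (z : Fin d → Bool)
    (hz : z ∈ gadgetZ p κ x) : hammingDist z x.1.1 ≤ 2 := by
  have key : ∀ u i, z ∈ endZ p κ u i → hammingDist z x.1.1 ≤ hammingDist u x.1.1 + 1 := by
    intro u i hu
    simp only [endZ, Finset.mem_insert, Finset.mem_singleton] at hu
    rcases hu with rfl | rfl | rfl | rfl
    · omega
    all_goals exact hammingDist_fl_le _ _ _
  rcases Finset.mem_union.1 hz with hz | hz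
  · have := key _ _ hz
    rw [hammingDist_self] at this; omega
  · have := key _ _ hz
    rwa [hammingDist_fl_self] at this

/-- The edges that a gadget with the fixed directions `Λ` and the free direction `m` may recolor:
those that still have their standard color, are not precolored, and whose list contains none of
the colors of the gadget. -/
def Free (p : (Fin d → Bool) → Fin d → Option (Fin d))
    (L : (Fin d → Bool) → Fin d → Finset (Fin d)) (U : (Fin d → Bool) → Fin d → Prop)
    (Λ : Finset (Fin d)) (m : Fin d) (w : Fin d → Bool) (l : Fin d) : Prop :=
  ¬ U w l ∧ p w l = none ∧ m ∉ L w l ∧ ∀ c ∈ Λ, c ∉ L w l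

lemma FirstStage.ncard_not_free_deg_le (hs : FirstStage T p L κ f U) (h : LocallySparse t p L)
    {Λ : Finset (Fin d)} (hΛ : Λ.card ≤ 5) (z : Fin d → Bool) :
    {m | ¬ Free p L U Λ m z m}.ncard ≤ T + 7 * t := by
  refine (ncard_le_of_imp (ncard_or_le (hs.U_deg z) (ncard_or_le (h.deg z) (ncard_or_le (h.diag z)
    ((ncard_exists_mem_le Λ fun c _ => h.list_deg z c).trans
      (Nat.mul_le_mul_right _ hΛ))))) ?_).trans (by omega)
  intro m hm
  by_contra hcon
  push Not at hcon
  exact hm hcon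

lemma FirstStage.ncard_not_free_par_le (hs : FirstStage T p L κ f U) (h : LocallySparse t p L)
    {Λ : Finset (Fin d)} (hΛ : Λ.card ≤ 5) (z : Fin d → Bool) (l : Fin d) :
    {m | ¬ Free p L U Λ m (fl z m) l}.ncard ≤ T + 7 * t := by
  have e1 := LocallySparse.ncard_parallel_le (q := fun u => p u l ≠ none) (by norm_num) (h.dir z l)
  have e2 : ∀ c ∈ Λ, {m | c ∈ L (fl z m) l}.ncard ≤ t := fun c _ =>
    LocallySparse.ncard_parallel_le (q := fun u => c ∈ L u l) (by norm_num) (h.list_dir z l c)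
  refine (ncard_le_of_imp (ncard_or_le (hs.U_par z l) (ncard_or_le e1 (ncard_or_le (h.diag_par z l)
    ((ncard_exists_mem_le Λ e2).trans (Nat.mul_le_mul_right _ hΛ))))) ?_).trans (by omega)
  intro m hm
  by_contra hcon
  push Not at hcon
  exact hm hcon

/-- The conditions on the free direction `m` of the gadget of a wrong edge. -/
structure Usable (p : (Fin d → Bool) → Fin d → Option (Fin d))
    (L : (Fin d → Bool) → Fin d → Finset (Fin d)) (κ : (Fin d → Bool) → Fin d → Fin d)
    (U : (Fin d → Bool) → Fin d → Prop) (x : Items (Wrong p)) (m : Fin d) : Prop where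
  notMem : m ∉ gadgetΛ p κ x
  left : m ∉ L x.1.1 (κ x.1.1 (target p x.1.1 x.1.2))
  right : m ∉ L (fl x.1.1 x.1.2) (κ (fl x.1.1 x.1.2) (target p x.1.1 x.1.2))
  deg : ∀ z ∈ gadgetZ p κ x, Free p L U (gadgetΛ p κ x) m z m
  par : ∀ z ∈ gadgetZ p κ x, ∀ l ∈ gadgetΛ p κ x, Free p L U (gadgetΛ p κ x) m (fl z m) l

lemma FirstStage.exists_usable (hs : FirstStage T p L κ f U) (h : LocallySparse t p L)
    (hd : 10 + 100 * (T + 8 * t) ≤ d) (x : Items (Wrong p)) :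
    ∃ A : Finset (Fin d), (∀ m ∈ A, Usable p L κ U x m) ∧ d ≤ 2 * A.card := by
  classical
  refine ⟨Finset.univ.filter fun m => Usable p L κ U x m, by simp, ?_⟩
  have hbad : {m | ¬ Usable p L κ U x m}.ncard ≤ 5 + 50 * (T + 8 * t) := by
    have hc := card_gadgetΛ_le p κ x
    have l : ∀ u i, {k | k ∈ L u i}.ncard ≤ t := fun u i => by
      rw [show {k | k ∈ L u i} = (L u i : Set (Fin d)) from rfl, Set.ncard_coe_finset]
      exact h.list u i
    have l' : {k | k ∈ gadgetΛ p κ x}.ncard ≤ 5 := by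
      rw [show {k | k ∈ gadgetΛ p κ x} = (gadgetΛ p κ x : Set (Fin d)) from rfl,
        Set.ncard_coe_finset]
      exact hc
    have e1 : {m | ∃ z ∈ gadgetZ p κ x, ¬ Free p L U (gadgetΛ p κ x) m z m}.ncard ≤
        8 * (T + 7 * t) :=
      (ncard_exists_mem_le _ fun z _ => hs.ncard_not_free_deg_le h hc z).trans
        (Nat.mul_le_mul_right _ (card_gadgetZ_le p κ x))
    have e2 : {m | ∃ z ∈ gadgetZ p κ x, ∃ l ∈ gadgetΛ p κ x,
        ¬ Free p L U (gadgetΛ p κ x) m (fl z m) l}.ncard ≤ 8 * (5 * (T + 7 * t)) :=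
      (ncard_exists_mem_le _ fun z _ => (ncard_exists_mem_le _ fun l _ =>
        hs.ncard_not_free_par_le h hc z l).trans (Nat.mul_le_mul_right _ hc)).trans
        (Nat.mul_le_mul_right _ (card_gadgetZ_le p κ x))
    refine (ncard_le_of_imp (ncard_or_le l' (ncard_or_le
      (l x.1.1 (κ x.1.1 (target p x.1.1 x.1.2))) (ncard_or_le
      (l (fl x.1.1 x.1.2) (κ (fl x.1.1 x.1.2) (target p x.1.1 x.1.2)))
      (ncard_or_le e1 e2)))) ?_).trans (by omega)
    intro m hm
    by_contra hcon
    push Not at hcon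
    exact hm ⟨hcon.1, hcon.2.1, hcon.2.2.1, hcon.2.2.2.1, hcon.2.2.2.2⟩
  have hsum := Finset.card_filter_add_card_filter_not (s := (Finset.univ : Finset (Fin d)))
    (fun m => Usable p L κ U x m)
  rw [Set.ncard_eq_toFinset_card'] at hbad
  have e : ({m | ¬ Usable p L κ U x m} : Set (Fin d)).toFinset =
      Finset.univ.filter fun m => ¬ Usable p L κ U x m := by ext; simp
  rw [e] at hbad
  simp only [Finset.card_univ, Fintype.card_fin] at hsum
  omega

lemma FirstStage.free_of_gen (hs : FirstStage T p L κ f U) (h : LocallySparse t p L)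
    {x : Items (Wrong p)} {m : Fin d} (hm : Usable p L κ U x m) {w : Fin d → Bool} {l : Fin d}
    (hg : Gen (gadgetZ p κ x) (gadgetΛ p κ x) m w l) : Free p L U (gadgetΛ p κ x) m w l := by
  refine hg.induct hm.deg hm.par fun w l hq => ?_
  unfold Free at hq ⊢
  rw [h.p_symm, h.L_symm] at hq
  exact ⟨fun hU => hq.1 (hs.U_flip _ _ hU), hq.2⟩

/-- The edges outside of the generic part of the gadget of a wrong edge whose colors change: the
edge itself, and the edges from which its prescribed color is taken. -/
def Forced (p : (Fin d → Bool) → Fin d → Option (Fin d)) (κ : (Fin d → Bool) → Fin d → Fin d)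
    (x : Items (Wrong p)) (w : Fin d → Bool) (l : Fin d) : Prop :=
  SameEdge w l x.1.1 x.1.2 ∨ ∃ u, (u = x.1.1 ∨ u = fl x.1.1 x.1.2) ∧
    SameEdge w l u (κ u (target p u x.1.2))

lemma SameEdge.of_flip {q : (Fin d → Bool) → Fin d → Prop} (hq : ∀ w l, q w l → q (fl w l) l)
    {w v : Fin d → Bool} {l i : Fin d} (h : SameEdge w l v i) (hv : q v i) : q w l := by
  obtain ⟨rfl, rfl | rfl⟩ := h
  · exact hv
  · exact hq _ _ hv

lemma LocallySparse.wrong_end (h : LocallySparse t p L) (x : Items (Wrong p)) {u : Fin d → Bool}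
    (hu : u = x.1.1 ∨ u = fl x.1.1 x.1.2) : Wrong p u x.1.2 := by
  rcases hu with rfl | rfl
  · exact x.2.1
  · exact (h.wrong_flip _ _).2 x.2.1

lemma FirstStage.forced_u (hs : FirstStage T p L κ f U) (h : LocallySparse t p L)
    {x : Items (Wrong p)} {w : Fin d → Bool} {l : Fin d} (hx : Forced p κ x w l) : U w l := by
  rcases hx with hx | ⟨u, hu, hx⟩
  · exact hx.of_flip hs.U_flip (hs.U_bad _ _ x.2.1.bad)
  · exact hx.of_flip hs.U_flip (hs.U_κ _ _ (h.wrong_end x hu).bad_target)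

/-- The forced edges of distinct wrong edges are distinct. -/
lemma FirstStage.eq_of_forced (hs : FirstStage T p L κ f U) (h : LocallySparse t p L)
    {x y : Items (Wrong p)} {w : Fin d → Bool} {l : Fin d} (hx : Forced p κ x w l)
    (hy : Forced p κ y w l) : x = y := by
  have b1 : ∀ z : Items (Wrong p), SameEdge w l z.1.1 z.1.2 → Bad p L w l := fun z hz =>
    hz.of_flip (fun w l => (h.bad_flip w l).2) z.2.1.bad
  have b2 : ∀ (z : Items (Wrong p)) u, (u = z.1.1 ∨ u = fl z.1.1 z.1.2) →
      SameEdge w l u (κ u (target p u z.1.2)) → ¬ Bad p L w l := fun z u hu hz =>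
    hz.of_flip (q := fun w l => ¬ Bad p L w l) (fun w l => (not_congr (h.bad_flip w l)).2)
      (hs.not_bad_κ _ _ (h.wrong_end z hu).bad_target)
  rcases hx with hx | ⟨u, hu, hx⟩ <;> rcases hy with hy | ⟨u', hu', hy⟩
  · obtain ⟨e, hx⟩ := hx
    obtain ⟨e', hy⟩ := hy
    rw [← e] at hx; rw [← e'] at hy
    exact Items.ext_of_dir e.symm e'.symm hx hy
  · exact absurd (b1 x hx) (b2 y u' hu' hy)
  · exact absurd (b1 y hy) (b2 x u hu hx)
  · obtain ⟨e, hx⟩ := hx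
    obtain ⟨e', hy⟩ := hy
    have w1 := h.wrong_end x hu
    have w2 := h.wrong_end y hu'
    have hw : u' = u ∨ u' = fl u (κ u (target p u x.1.2)) := by
      rw [← e'] at hy
      rw [← e] at hx ⊢
      rcases hx with rfl | rfl <;> rcases hy with hy | hy
      · exact Or.inl hy.symm
      · exact Or.inr (fl_eq_iff.1 hy.symm)
      · exact Or.inr hy.symm
      · exact Or.inl (fl_inj_left.1 hy).symm
    obtain ⟨rfl, e2⟩ := hs.distinct _ _ _ _ w1.bad_target w2.bad_target (e.symm.trans e') hw
    have e3 := h.eq_of_target w1 w2 e2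
    refine Items.ext_of_dir rfl e3.symm hu ?_
    rw [e3]; exact hu'

/-- The gadget of a wrong edge for a usable direction gives the edge its prescribed color, and
allowed colors to all edges that it changes. -/
lemma FirstStage.exists_gadget (hs : FirstStage T p L κ f U) (h : LocallySparse t p L)
    {x : Items (Wrong p)} {m : Fin d} (hm : Usable p L κ U x m) :
    ∃ g, IsProper g ∧ g x.1.1 x.1.2 = target p x.1.1 x.1.2 ∧ ∀ w l, g w l = f w l ∨
      (g w l ∉ L w l ∧ (Forced p κ x w l ∨ Gen (gadgetZ p κ x) (gadgetΛ p κ x) m w l)) := by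
  have free := fun w l hg => hs.free_of_gen h (w := w) (l := l) hm hg
  obtain ⟨⟨v, i⟩, hv, hv0⟩ := x
  simp only at hv hv0 ⊢
  have hv' := (h.wrong_flip v i).2 hv
  have hj' : target p (fl v i) i = target p v i := h.target_flip v i
  have b1 : Bad p L v i := hv.bad
  have b1' : Bad p L (fl v i) i := hv'.bad
  have b2 : Bad p L v (target p v i) := hv.bad_target
  have b2' : Bad p L (fl v i) (target p v i) := by rw [← hj']; exact hv'.bad_target
  have hij : i ≠ target p v i := hv.target.2.symm
  have ne : ∀ u a b, Bad p L u a → Bad p L u b → a ≠ κ u b := fun u a b ha hb e =>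
    hs.not_bad_κ u b hb (e ▸ ha)
  obtain ⟨g, hg, hgi, hgd⟩ := hs.proper.exists_gadget (v := v) (i := i) (j := target p v i)
    (k := κ v i) (p := κ v (target p v i)) (q := κ (fl v i) (target p v i)) (m := m)
    (Z := gadgetZ p κ ⟨(v, i), hv, hv0⟩) (Λ := gadgetΛ p κ ⟨(v, i), hv, hv0⟩) hij
    (ne _ _ _ b1 b2) (ne _ _ _ b1' b2') (ne _ _ _ b2 b1)
    (fun e => hij (hs.distinct _ _ _ _ b1 b2 e (Or.inl rfl)).2)
    (fun e => hij (hs.distinct _ _ _ _ b1' b2' ((hs.κ_symm v i).trans e) (Or.inl rfl)).2)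
    (by
      intro l hl
      simp only [gadgetΛ, Finset.mem_insert, Finset.mem_singleton]
      tauto) hm.notMem
    (by
      intro u hu
      simp only [gadgetZ, endZ, Finset.mem_union, Finset.mem_insert, Finset.mem_singleton, hj']
      tauto)
    (hs.f_bad _ _ b1) (hs.f_κ _ _ b2) (hs.f_κ _ _ b2')
    (fun w l hg => hs.f_std w l (free w l hg).1)
  refine ⟨g, hg, hgi, fun w l => ?_⟩
  have same : ∀ {u a c}, SameEdge w l u a → c ∉ L u a → c ∉ L w l := fun {u a c} hw hc =>
    hw.of_flip (q := fun w l => c ∉ L w l) (fun w l hq => by rwa [h.L_symm]) hc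
  rcases hgd w l with e | ⟨hw, e⟩ | ⟨hw, e⟩ | ⟨hw, e⟩ | ⟨hw, e⟩ | ⟨hw, e⟩
  · exact Or.inl e
  · exact Or.inr ⟨e ▸ same hw (h.notMem _ _ _ hv.target.1), Or.inl (Or.inl hw)⟩
  · exact Or.inr ⟨e ▸ same hw hm.left, Or.inl (Or.inr ⟨v, Or.inl rfl, hw⟩)⟩
  · refine Or.inr ⟨e ▸ same hw hm.right, Or.inl (Or.inr ⟨fl v i, Or.inr rfl, ?_⟩)⟩
    rw [hj']; exact hw
  · exact Or.inr ⟨(free w l hw).2.2.2 _ e, Or.inr hw⟩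
  · exact Or.inr ⟨e ▸ (free w l hw).2.2.1, Or.inr hw⟩

lemma LocallySparse.not_bad_of_self (h : LocallySparse t p L) {v : Fin d → Bool} {i : Fin d}
    (hi : p v i = some i) : ¬ Bad p L v i := by
  rintro (⟨c, hc, e⟩ | ⟨i', hi', e | e⟩ | e)
  · exact hc (Option.some.inj (e.symm.trans hi))
  · exact hi' (h.proper v _ _ i e hi)
  · exact hi' (h.proper (fl v i) _ _ i e (by rw [h.p_symm, hi]))
  · exact h.notMem v i i hi e

/-- A locally sparse precoloring extends to a proper coloring that avoids the lists. -/
theorem LocallySparse.exists_coloring (h : LocallySparse t p L) (hd : 10 ^ 15 * t < d) :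
    ∃ f, IsProper f ∧ (∀ v i c, p v i = some c → f v i = c) ∧ ∀ v i, f v i ∉ L v i := by
  classical
  -- for `t = 0` nothing is precolored or forbidden; otherwise `d` exceeds `10 ^ 15`
  rcases Nat.eq_zero_or_pos t with rfl | ht
  · have hp : ∀ v i, p v i = none := by
      intro v i
      have := h.deg v
      rw [Nat.le_zero, Set.ncard_eq_zero (Set.toFinite _)] at this
      by_contra hne
      exact Set.eq_empty_iff_forall_notMem.1 this i hne
    have hL : ∀ v i, L v i = ∅ := fun v i => by
      have := h.list v i
      rwa [Nat.le_zero, Finset.card_eq_zero] at this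
    exact ⟨fun _ l => l, ⟨fun _ _ => rfl, fun _ _ _ h => h⟩, by simp [hp], by simp [hL]⟩
  obtain ⟨κ, f, U, hs⟩ := h.exists_firstStage (by omega)
  choose A hA hAd using hs.exists_usable h (by omega)
  -- `18576` is the constant that `exists_disjoint_gadgets` requires for `c = 8`
  obtain ⟨o, hoA, hdis, -, -⟩ := exists_disjoint_gadgets (ι := Items (Wrong p))
    (c := 8) (t := 100000 * t) (r := 2) (R := 8) (C := 18576) (base := fun x => x.1.1)
    (Z := gadgetZ p κ) (Λ := gadgetΛ p κ) (A := A) (card_gadgetZ_le p κ)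
    (fun x => (card_gadgetΛ_le p κ x).trans (by norm_num)) hammingDist_le_of_mem_gadgetZ
    (by norm_num) (fun u => (hs.ncard_mem_gadgetZ_le h u).trans (by omega))
    (fun w l => (hs.ncard_mem_gadgetΛ_le h w l).trans (by omega))
    (fun w => (Items.ncard_near_le fun l => h.wrong_dir (by norm_num) w l).trans
      (Nat.mul_le_mul_right _ (by omega))) hAd (by norm_num) (by norm_num) (by omega)
  have hm : ∀ x, Usable p L κ U x (o x) := fun x => hA x _ (hoA x)
  choose F hF hFx hFd using fun x => hs.exists_gadget h (hm x)
  have hFdis : ∀ x y, x ≠ y → ∀ w l, F x w l ≠ f w l → F y w l = f w l := by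
    intro x y hxy w l hx
    by_contra hy
    rcases ((hFd x w l).resolve_left hx).2 with hx | hx <;>
      rcases ((hFd y w l).resolve_left hy).2 with hy | hy
    · exact hxy (hs.eq_of_forced h hx hy)
    · exact (hs.free_of_gen h (hm y) hy).1 (hs.forced_u h hx)
    · exact (hs.free_of_gen h (hm x) hx).1 (hs.forced_u h hy)
    · exact hdis x y hxy w l hx hy
  obtain ⟨g, hg, hg1, hg2⟩ := exists_merge hs.proper hF hFdis
  refine ⟨g, hg, fun v i c hc => ?_, fun w l => ?_⟩
  · by_cases hci : c = i
    · subst hci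
      have hb := h.not_bad_of_self hc
      have hU : ¬ U v c := fun hU => by
        rcases hs.U_uncolored v c hU with e | e
        · exact hb e
        · rw [hc] at e; exact Option.some_ne_none _ e
      rw [hg2, hs.f_std v c hU]
      intro x
      rcases hFd x v c with e | ⟨-, hx | hx⟩
      · exact e
      · exact absurd (hs.forced_u h hx) hU
      · have := (hs.free_of_gen h (hm x) hx).2.1
        rw [hc] at this
        exact absurd this (Option.some_ne_none _)
    · have hw : Wrong p v i := ⟨c, hci, hc⟩
      obtain ⟨x, rfl, hv⟩ := Items.exists_of h.wrong_flip hw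
      have ht : target p v x.1.2 = c := by simp [target, hc]
      have e : F x v x.1.2 = target p v x.1.2 := by
        rcases hv with e | e
        · rw [e]; exact hFx x
        · rw [e, (hF x).symm, h.target_flip]; exact hFx x
      rw [hg1 x v x.1.2, e, ht]
      rw [e, hs.f_bad v _ hw.bad]
      intro e'
      exact hs.not_bad_κ v _ hw.bad (e' ▸ hw.bad_target)
  · by_cases hx : ∃ x, F x w l ≠ f w l
    · obtain ⟨x, hx⟩ := hx
      rw [hg1 x w l hx]
      exact ((hFd x w l).resolve_left hx).1
    · push Not at hx
      rw [hg2 w l hx]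
      exact hs.f_notMem w l

end

end

/-! ### Choice of a permutation by the first moment method -/

section

lemma pow_self_le_three_pow_mul_factorial (d : ℕ) : d ^ d ≤ 3 ^ d * d.factorial := by
  have h1 := Real.pow_div_factorial_le_exp (x := (d : ℝ)) (Nat.cast_nonneg d) d
  have h2 : Real.exp d ≤ 3 ^ d := by
    rw [← mul_one (d : ℝ), Real.exp_nat_mul]
    exact pow_le_pow_left₀ (Real.exp_pos _).le
      (Real.exp_one_lt_d9.le.trans (by norm_num)) d
  have h3 : (0 : ℝ) < d.factorial := by exact_mod_cast d.factorial_pos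
  rw [div_le_iff₀ h3] at h1
  have : (d : ℝ) ^ d ≤ 3 ^ d * d.factorial := h1.trans (mul_le_mul_of_nonneg_right h2 h3.le)
  exact_mod_cast this

open Classical in
/-- Few permutations hit a sparse relation often: the weights `λ = 100 ^ M` of the pairs in the
relation are summed over all functions instead of all permutations. -/
lemma card_perm_hits_le {d M : ℕ} (hM : 0 < M) (B : Fin d → Fin d → Prop)
    (hB : ∀ j, {c | B j c}.ncard * 100 ^ M ≤ d) :
    100 ^ d * (Finset.univ.filter fun σ : Equiv.Perm (Fin d) =>
      d / M < {j | B j (σ j)}.ncard).card ≤ 6 ^ d * d.factorial := by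
  let w : Fin d → Fin d → ℕ := fun j c => if B j c then 100 ^ M else 1
  have hprod : ∀ σ : Equiv.Perm (Fin d), ∏ j, w j (σ j) = (100 ^ M) ^ {j | B j (σ j)}.ncard := by
    intro σ
    simp only [w]
    rw [Finset.prod_ite, Finset.prod_const, Finset.prod_const_one, mul_one,
      Set.ncard_eq_toFinset_card']
    congr 2; ext; simp
  have hrow : ∀ j, ∑ c, w j c ≤ 2 * d := by
    intro j
    simp only [w]
    rw [Finset.sum_ite, Finset.sum_const, Finset.sum_const, smul_eq_mul, smul_eq_mul]
    have e1 : (Finset.univ.filter fun c => B j c).card * 100 ^ M ≤ d := by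
      refine le_trans (le_of_eq ?_) (hB j)
      rw [Set.ncard_eq_toFinset_card']
      congr 2; ext; simp
    have e2 : (Finset.univ.filter fun c => ¬ B j c).card ≤ d :=
      (Finset.card_le_univ _).trans (by simp)
    omega
  have hlow : ∀ σ ∈ (Finset.univ.filter fun σ : Equiv.Perm (Fin d) =>
      d / M < {j | B j (σ j)}.ncard), 100 ^ d ≤ ∏ j, w j (σ j) := by
    intro σ hσ
    rw [hprod, ← pow_mul]
    refine Nat.pow_le_pow_right (by norm_num) ?_
    have h1 : d / M + 1 ≤ {j | B j (σ j)}.ncard := (Finset.mem_filter.1 hσ).2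
    calc d ≤ M * (d / M + 1) := (Nat.lt_mul_div_succ d hM).le
      _ ≤ _ := Nat.mul_le_mul_left _ h1
  have hinj : Function.Injective fun (σ : Equiv.Perm (Fin d)) => (σ : Fin d → Fin d) :=
    fun _ _ h => DFunLike.coe_injective h
  calc 100 ^ d * (Finset.univ.filter fun σ : Equiv.Perm (Fin d) =>
        d / M < {j | B j (σ j)}.ncard).card
      = (Finset.univ.filter fun σ : Equiv.Perm (Fin d) =>
        d / M < {j | B j (σ j)}.ncard).card • 100 ^ d := by rw [smul_eq_mul, mul_comm]
    _ ≤ ∑ σ ∈ (Finset.univ.filter fun σ : Equiv.Perm (Fin d) =>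
        d / M < {j | B j (σ j)}.ncard), ∏ j, w j (σ j) := Finset.card_nsmul_le_sum _ _ _ hlow
    _ ≤ ∑ σ : Equiv.Perm (Fin d), ∏ j, w j (σ j) :=
      Finset.sum_le_sum_of_subset (Finset.filter_subset _ _)
    _ = ∑ f ∈ Finset.univ.map ⟨_, hinj⟩, ∏ j, w j (f j) := by rw [Finset.sum_map]; rfl
    _ ≤ ∑ f : Fin d → Fin d, ∏ j, w j (f j) :=
      Finset.sum_le_sum_of_subset (Finset.subset_univ _)
    _ = ∏ j, ∑ c, w j c := (Fintype.prod_sum w).symm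
    _ ≤ ∏ _j : Fin d, 2 * d := Finset.prod_le_prod' fun j _ => hrow j
    _ = 2 ^ d * d ^ d := by simp [mul_pow]
    _ ≤ 2 ^ d * (3 ^ d * d.factorial) :=
      Nat.mul_le_mul_left _ (pow_self_le_three_pow_mul_factorial d)
    _ = 6 ^ d * d.factorial := by rw [← mul_assoc, ← mul_pow]; norm_num

/-- First moment method: exponentially many sparse relations admit a permutation that hits none
of them often. -/
theorem exists_perm_few_hits {d M : ℕ} (hd : 0 < d) (hM : 0 < M) {S : Type*} [Fintype S]
    (hS : Fintype.card S ≤ 8 ^ d) (B : S → Fin d → Fin d → Prop)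
    (hB : ∀ s j, {c | B s j c}.ncard * 100 ^ M ≤ d) :
    ∃ σ : Equiv.Perm (Fin d), ∀ s, {j | B s j (σ j)}.ncard ≤ d / M := by
  classical
  by_contra! hcon
  have hcover : (Finset.univ : Finset (Equiv.Perm (Fin d))) ⊆
      Finset.univ.biUnion fun s => Finset.univ.filter fun σ : Equiv.Perm (Fin d) =>
        d / M < {j | B s j (σ j)}.ncard := by
    intro σ _
    obtain ⟨s, hs⟩ := hcon σ
    simp only [Finset.mem_biUnion, Finset.mem_filter, Finset.mem_univ, true_and]
    exact ⟨s, hs⟩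
  have h1 := (Finset.card_le_card hcover).trans Finset.card_biUnion_le
  rw [Finset.card_univ, Fintype.card_perm, Fintype.card_fin] at h1
  have h2 : 100 ^ d * d.factorial ≤ 8 ^ d * (6 ^ d * d.factorial) := by
    calc 100 ^ d * d.factorial ≤ ∑ s : S, 100 ^ d * (Finset.univ.filter
          fun σ : Equiv.Perm (Fin d) => d / M < {j | B s j (σ j)}.ncard).card := by
          rw [← Finset.mul_sum]; exact Nat.mul_le_mul_left _ h1
      _ ≤ ∑ _s : S, 6 ^ d * d.factorial :=
        Finset.sum_le_sum fun s _ => by convert card_perm_hits_le hM (B s) (hB s)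
      _ = Fintype.card S * (6 ^ d * d.factorial) := by simp
      _ ≤ _ := Nat.mul_le_mul_right _ hS
  rw [← mul_assoc, ← mul_pow] at h2
  have h3 := Nat.le_of_mul_le_mul_right h2 d.factorial_pos
  exact absurd h3 (not_le.2 (Nat.pow_lt_pow_left (by norm_num) hd.ne'))

end

/-! ### Edges and dimensional matchings of the hypercube -/

section

variable {d : ℕ}

lemma hypercube_adj_fl (v : Fin d → Bool) (i : Fin d) : (hypercube d).Adj v (fl v i) := by
  change hammingDist v (fl v i) = 1
  rw [hammingDist_comm, hammingDist_fl_self]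

lemma hypercube_adj_iff {v w : Fin d → Bool} : (hypercube d).Adj v w ↔ ∃ i, w = fl v i := by
  constructor
  · intro h
    have h : hammingDist v w = 1 := h
    rw [hammingDist, Finset.card_eq_one] at h
    obtain ⟨i, hi⟩ := h
    refine ⟨i, funext fun l => ?_⟩
    have hl := Finset.ext_iff.1 hi l
    simp only [Finset.mem_filter, Finset.mem_univ, true_and, Finset.mem_singleton] at hl
    by_cases e : l = i
    · rw [e] at hl ⊢
      rw [fl_same]
      have := hl.2 rfl
      revert this; cases v i <;> cases w i <;> simp
    · rw [fl_of_ne _ e]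
      by_contra hne
      exact e (hl.1 (Ne.symm hne))
  · rintro ⟨i, rfl⟩; exact hypercube_adj_fl v i

/-- The edge of the hypercube at the vertex `v` in direction `i`. -/
def edge (v : Fin d → Bool) (i : Fin d) : (hypercube d).edgeSet :=
  ⟨s(v, fl v i), hypercube_adj_fl v i⟩

lemma mem_edge {u v : Fin d → Bool} {i : Fin d} :
    u ∈ (edge v i : Sym2 (Fin d → Bool)) ↔ u = v ∨ u = fl v i := by simp [edge]

lemma edge_flip (v : Fin d → Bool) (i : Fin d) : edge (fl v i) i = edge v i := by
  apply Subtype.ext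
  simp only [edge, fl_fl]
  exact Sym2.eq_swap

lemma edge_surj (e : (hypercube d).edgeSet) : ∃ v i, e = edge v i := by
  obtain ⟨e, he⟩ := e
  induction e using Sym2.inductionOn with
  | hf v w =>
    obtain ⟨i, rfl⟩ := hypercube_adj_iff.1 ((SimpleGraph.mem_edgeSet _).1 he)
    exact ⟨v, i, rfl⟩

lemma edge_eq {v w : Fin d → Bool} {i l : Fin d} (h : edge v i = edge w l) :
    i = l ∧ (v = w ∨ v = fl w l) := by
  have h1 : v = w ∨ v = fl w l := by rw [← mem_edge, ← h, mem_edge]; exact Or.inl rfl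
  have h2 : fl v i = w ∨ fl v i = fl w l := by rw [← mem_edge, ← h, mem_edge]; exact Or.inr rfl
  refine ⟨?_, h1⟩
  rcases h1 with rfl | rfl
  · rcases h2 with h2 | h2
    · exact absurd h2 (fl_ne _ _)
    · exact fl_inj_right.1 h2
  · rcases h2 with h2 | h2
    · rw [fl_eq_iff] at h2
      exact (fl_inj_right.1 h2).symm
    · exact absurd h2 (fl_ne _ _)

lemma exists_edge_of_mem {e : (hypercube d).edgeSet} {v : Fin d → Bool}
    (h : v ∈ (e : Sym2 (Fin d → Bool))) : ∃ i, e = edge v i := by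
  obtain ⟨w, i, rfl⟩ := edge_surj e
  rcases mem_edge.1 h with rfl | rfl
  · exact ⟨i, rfl⟩
  · exact ⟨i, (edge_flip w i).symm⟩

lemma edist_le_hammingDist (n : ℕ) : ∀ v w : Fin d → Bool, hammingDist v w ≤ n →
    (hypercube d).edist v w ≤ n := by
  induction n with
  | zero =>
    intro v w h
    rw [Nat.le_zero, hammingDist_eq_zero] at h
    simp [h]
  | succ n ih =>
    intro v w h
    by_cases hvw : v = w
    · simp [hvw]
    · obtain ⟨i, hi⟩ : ∃ i, v i ≠ w i := by
        by_contra! hcon; exact hvw (funext hcon)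
      have h1 : hammingDist (fl v i) w ≤ n := by
        have : hammingDist (fl v i) w < hammingDist v w := by
          apply Finset.card_lt_card
          rw [Finset.ssubset_iff_of_subset]
          · refine ⟨i, by simpa using hi, ?_⟩
            simp only [Finset.mem_filter, Finset.mem_univ, true_and, fl_same, not_not]
            revert hi; cases v i <;> cases w i <;> simp
          · intro l
            simp only [Finset.mem_filter, Finset.mem_univ, true_and]
            intro hl
            by_cases e : l = i
            · rw [e]; exact hi
            · rwa [fl_of_ne _ e] at hl
        omega
      have h2 := SimpleGraph.edist_triangle (G := hypercube d) (u := v) (v := fl v i) (w := w)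
      rw [SimpleGraph.edist_eq_one_iff_adj.2 (hypercube_adj_fl v i)] at h2
      refine h2.trans ?_
      rw [Nat.cast_succ, add_comm]
      exact add_le_add_left (ih _ _ h1) 1

lemma edge_mem_neighborhood {v w : Fin d → Bool} (i l : Fin d) (h : hammingDist v w ≤ 26) :
    edge v i ∈ edgeNeighborhood (hypercube d) 27 (edge w l) := by
  refine ⟨w, mem_edge.2 (Or.inl rfl), v, mem_edge.2 (Or.inl rfl), ?_⟩
  rw [hammingDist_comm] at h
  exact edist_le_hammingDist 27 w v (by omega)

/-- The matching formed by all edges of direction `i`. -/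
def dirMatching (i : Fin d) : (hypercube d).Subgraph where
  verts := Set.univ
  Adj v w := w = fl v i
  adj_sub := by rintro v w rfl; exact hypercube_adj_fl v i
  edge_vert := by intros; exact Set.mem_univ _
  symm := ⟨by rintro v w rfl; rw [fl_fl]⟩

lemma edge_mem_dirMatching (v : Fin d → Bool) (i : Fin d) :
    (edge v i : Sym2 (Fin d → Bool)) ∈ (dirMatching i).edgeSet := by
  simp [edge, dirMatching]

lemma hammingDist_insertNth {n : ℕ} (i : Fin (n + 1)) (a b : Bool) (x y : Fin n → Bool) :
    hammingDist (i.insertNth a x : Fin (n + 1) → Bool) (i.insertNth b y : Fin (n + 1) → Bool) =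
      (if a ≠ b then 1 else 0) + hammingDist x y := by
  simp only [hammingDist, Finset.card_filter]
  rw [Fin.sum_univ_succAbove _ i]
  simp

lemma fl_insertNth {n : ℕ} (i : Fin (n + 1)) (a : Bool) (x : Fin n → Bool) :
    fl (i.insertNth a x : Fin (n + 1) → Bool) i = i.insertNth (!a) x := by
  simp [fl]

/-- The matching of direction `i` is a dimensional matching: deleting it leaves the two facets
orthogonal to that direction. -/
lemma isDimensionalMatching_dirMatching (i : Fin d) : IsDimensionalMatching (dirMatching i) := by
  refine ⟨SimpleGraph.Subgraph.isPerfectMatching_iff.2 fun v => ⟨fl v i, rfl, fun w hw => hw⟩, ?_⟩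
  obtain ⟨n, rfl⟩ : ∃ n, d = n + 1 := ⟨d - 1, by have := i.pos; omega⟩
  let e : (Fin n → Bool) ⊕ (Fin n → Bool) ≃ (Fin (n + 1) → Bool) :=
    (Equiv.boolProdEquivSum (Fin n → Bool)).symm.trans (Fin.insertNthEquiv (fun _ => Bool) i)
  have el : ∀ x, e (Sum.inl x) = i.insertNth false x := fun _ => rfl
  have er : ∀ x, e (Sum.inr x) = i.insertNth true x := fun _ => rfl
  have hadj : ∀ v w, ((hypercube (n + 1)).deleteEdges (dirMatching i).edgeSet).Adj v w ↔
      hammingDist v w = 1 ∧ w ≠ fl v i := by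
    intro v w
    rw [SimpleGraph.deleteEdges_adj]
    rfl
  have same : ∀ (a : Bool) (x y : Fin n → Bool),
      (i.insertNth a x : Fin (n + 1) → Bool) ≠ i.insertNth (!a) y := by
    intro a x y h
    have := congrFun h i
    simp at this
  refine ⟨(RelIso.symm ⟨e, ?_⟩)⟩
  rintro (x | x) (y | y)
  · rw [hadj, el, el, fl_insertNth, hammingDist_insertNth, SimpleGraph.sum_adj_inl]
    simp only [ne_eq, not_true_eq_false, if_false, zero_add]
    exact ⟨fun h => h.1, fun h => ⟨h, same _ _ _⟩⟩
  · rw [hadj, el, er, fl_insertNth, hammingDist_insertNth]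
    simp only [ne_eq, Bool.false_eq_true, not_false_eq_true, if_true, Nat.add_eq_left,
      hammingDist_eq_zero, Bool.not_false, SimpleGraph.sum, iff_false, not_and, not_not]
    rintro rfl; rfl
  · rw [hadj, el, er, fl_insertNth, hammingDist_insertNth]
    simp only [ne_eq, Bool.true_eq_false, not_false_eq_true, if_true, Nat.add_eq_left,
      hammingDist_eq_zero, Bool.not_true, SimpleGraph.sum, Bool.false_eq_true, iff_false, not_and, not_not]
    rintro rfl; rfl
  · rw [hadj, er, er, fl_insertNth, hammingDist_insertNth, SimpleGraph.sum_adj_inr]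
    simp only [ne_eq, not_true_eq_false, if_false, zero_add]
    exact ⟨fun h => h.1, fun h => ⟨h, same _ _ _⟩⟩

end

/-! ### Transfer to the hypercube -/

section

variable {d M : ℕ}

/-- A count that is at most `α d` with `α = 100 ^ (-M)` is small enough for the first moment
method, and its double, which counts both orientations of edges, is at most `d / M`. -/
lemma two_mul_le_div {n : ℕ} (hM : 0 < M) (h : (n : ℝ) ≤ (1 / 100 ^ M : ℝ) * d) :
    n * 100 ^ M ≤ d ∧ n * 2 ≤ d / M := by
  have hpos : (0 : ℝ) < 100 ^ M := by positivity
  have h1 : n * 100 ^ M ≤ d := by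
    rw [one_div, ← div_eq_inv_mul, le_div_iff₀ hpos] at h
    exact_mod_cast h
  refine ⟨h1, ?_⟩
  rw [Nat.le_div_iff_mul_le hM]
  refine le_trans ?_ h1
  rw [mul_assoc]
  refine Nat.mul_le_mul_left _ ?_
  have h2 : M < 2 ^ M := Nat.lt_two_pow_self
  have h3 : 2 * 2 ^ M ≤ 100 ^ M := by
    have : 2 ^ M ≤ 50 ^ M := Nat.pow_le_pow_left (by norm_num) M
    have e : (100 : ℕ) ^ M = 2 ^ M * 50 ^ M := by rw [← mul_pow]; norm_num
    have h50 : 2 ≤ 50 ^ M := le_trans (by norm_num) (Nat.pow_le_pow_right (by norm_num) hM)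
    rw [e, mul_comm]
    exact Nat.mul_le_mul_left _ h50
  omega

lemma card_index_le (hd : 0 < d) :
    Fintype.card ((Fin d → Bool) ⊕ ((Fin d → Bool) × Fin d) ⊕ (Fin d → Bool)) ≤ 8 ^ d := by
  simp only [Fintype.card_sum, Fintype.card_prod, Fintype.card_fun, Fintype.card_bool,
    Fintype.card_fin]
  have h1 : d < 2 ^ d := Nat.lt_two_pow_self
  have h2 : 2 ≤ 2 ^ d := by
    calc 2 = 2 ^ 1 := rfl
      _ ≤ 2 ^ d := Nat.pow_le_pow_right (by norm_num) hd
  have e : (8 : ℕ) ^ d = 2 ^ d * (2 ^ d * 2 ^ d) := by rw [← mul_pow, ← mul_pow]; norm_num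
  rw [e]
  nlinarith

section
variable {φ : (hypercube d).edgeSet → Option (Fin d)} {L : (hypercube d).edgeSet → Finset (Fin d)}

lemma IsPrecoloring.eq_dir (hφ : IsPrecoloring φ) {v : Fin d → Bool} {i j c : Fin d}
    (hi : φ (edge v i) = some c) (hj : φ (edge v j) = some c) : i = j := by
  by_contra hne
  refine hφ (edge v i) (edge v j) (SimpleGraph.lineGraph_adj_iff_exists.2
    ⟨fun h => hne (edge_eq h).1, v, mem_edge.2 (Or.inl rfl), mem_edge.2 (Or.inl rfl)⟩) c hi hj

lemma ncard_edges_at_le {v : Fin d → Bool} {q : (hypercube d).edgeSet → Prop} {k : ℕ}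
    (h : {e : (hypercube d).edgeSet | v ∈ (e : Sym2 (Fin d → Bool)) ∧ q e}.ncard ≤ k) :
    {i | q (edge v i)}.ncard ≤ k := by
  refine ncard_le_of_inj_rel (fun i e => e = edge v i) h ?_ ?_
  · rintro e - i - j - rfl h
    exact (edge_eq h).1
  · intro i hi
    exact ⟨_, ⟨mem_edge.2 (Or.inl rfl), hi⟩, rfl⟩

lemma ncard_edges_near_le {q : (hypercube d).edgeSet → Prop} {k : ℕ} {w : Fin d → Bool}
    {l : Fin d} (h : {e : (hypercube d).edgeSet | e ∈ edgeNeighborhood (hypercube d) 27 (edge w l) ∧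
      q e}.ncard ≤ k) :
    {x : (Fin d → Bool) × Fin d | hammingDist x.1 w ≤ 26 ∧ q (edge x.1 x.2)}.ncard ≤ k * 2 := by
  refine ncard_le_mul_of_rel (fun x e => edge x.1 x.2 = e) h ?_ ?_
  · intro e _
    obtain ⟨v, i, rfl⟩ := edge_surj e
    refine (ncard_le_of_imp (ncard_or_le (ncard_eq_le_one (v, i)) (ncard_eq_le_one (fl v i, i))) ?_)
    rintro ⟨u, j⟩ ⟨-, h⟩
    obtain ⟨hj, hu⟩ := edge_eq h
    simp only at hj hu
    subst hj
    rcases hu with rfl | rfl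
    · exact Or.inl rfl
    · exact Or.inr rfl
  · rintro x ⟨hx, hq⟩
    exact ⟨_, ⟨edge_mem_neighborhood _ _ hx, hq⟩, rfl⟩

lemma ncard_parallel_edges_near_le {q : (hypercube d).edgeSet → Prop} {k : ℕ}
    {w : Fin d → Bool} {l : Fin d}
    (h : {e : (hypercube d).edgeSet | e ∈ edgeNeighborhood (hypercube d) 27 (edge w l) ∧
      (e : Sym2 (Fin d → Bool)) ∈ (dirMatching l).edgeSet ∧ q e}.ncard ≤ k) :
    {v : Fin d → Bool | hammingDist v w ≤ 26 ∧ q (edge v l)}.ncard ≤ k * 2 := by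
  refine ncard_le_of_inj_rel (fun v x => x = (v, l)) (ncard_edges_near_le h) ?_ ?_
  · rintro x - a - b - rfl h
    exact (Prod.ext_iff.1 h).1
  · rintro v ⟨hv, hq⟩
    exact ⟨(v, l), ⟨hv, edge_mem_dirMatching v l, hq⟩, rfl⟩

/-- After a suitable renaming `σ` of the colors, a dense precoloring and sparse lists are locally
sparse with respect to the standard coloring. -/
lemma exists_locallySparse (hd : 0 < d) (hM : 0 < M) (hφ : IsPrecoloring φ)
    (hα : IsDense (1 / 100 ^ M : ℝ) φ) (hβ : IsSparse (1 / 100 ^ M : ℝ) L)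
    (hL : ∀ e c, φ e = some c → c ∉ L e) :
    ∃ σ : Equiv.Perm (Fin d), LocallySparse (d / M) (fun v i => (φ (edge v i)).map σ.symm)
      (fun v i => (L (edge v i)).map σ.symm.toEmbedding) := by
  let B : (Fin d → Bool) ⊕ ((Fin d → Bool) × Fin d) ⊕ (Fin d → Bool) → Fin d → Fin d → Prop :=
    Sum.elim (fun v j c => c ∈ L (edge v j)) (Sum.elim (fun x m c => c ∈ L (edge (fl x.1 m) x.2))
      (fun v j c => ∃ i, φ (edge (fl v j) i) = some c))
  have row : ∀ e, {c | c ∈ L e}.ncard * 100 ^ M ≤ d := fun e => by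
    rw [show {c | c ∈ L e} = (L e : Set (Fin d)) from rfl, Set.ncard_coe_finset]
    exact (two_mul_le_div hM (hβ.edge e)).1
  obtain ⟨σ, hσ⟩ := exists_perm_few_hits hd hM (card_index_le hd) B (by
    rintro (v | x | v) j
    · exact row _
    · exact row _
    · refine le_trans (Nat.mul_le_mul_right _ ?_) (two_mul_le_div hM (hα.vertex (fl v j))).1
      refine ncard_le_of_inj_rel (fun c e => φ e = some c) le_rfl ?_ ?_
      · rintro e - a - b - ha hb
        exact Option.some.inj (ha.symm.trans hb)
      · rintro c ⟨i, hi⟩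
        exact ⟨edge (fl v j) i, ⟨mem_edge.2 (Or.inl rfl), by rw [hi]; exact Option.some_ne_none _⟩,
          hi⟩)
  have mapsome : ∀ (o : Option (Fin d)) c, o.map σ.symm = some c ↔ o = some (σ c) := by
    intro o c
    cases o with
    | none => simp
    | some a => simp [Equiv.symm_apply_eq]
  have mapnone : ∀ (o : Option (Fin d)), o.map σ.symm ≠ none ↔ o ≠ none := by
    intro o; cases o <;> simp
  have memL : ∀ (s : Finset (Fin d)) c, c ∈ s.map σ.symm.toEmbedding ↔ σ c ∈ s := by
    intro s c
    simp [Finset.mem_map_equiv]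
  have half : ∀ {n : ℕ}, n * 2 ≤ d / M → n ≤ d / M := fun h => by omega
  refine ⟨σ, ⟨?_, ?_, ?_, ?_, ?_, ?_, ?_, ?_, ?_, ?_, ?_, ?_, ?_⟩⟩
  · intro v i; simp only [edge_flip]
  · intro v i; simp only [edge_flip]
  · intro v i i' c h1 h2
    rw [mapsome] at h1 h2
    exact IsPrecoloring.eq_dir hφ h1 h2
  · intro v i c h1
    rw [mapsome] at h1
    rw [memL]
    exact hL _ _ h1
  · intro v
    simp only [mapnone]
    exact ncard_edges_at_le (half (two_mul_le_div hM (hα.vertex v)).2)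
  · intro w c
    simp only [mapsome]
    exact (ncard_edges_near_le (l := ⟨0, hd⟩) le_rfl).trans
      (two_mul_le_div hM (hα.color (edge w ⟨0, hd⟩) (σ c))).2
  · intro w l
    simp only [mapnone]
    exact (ncard_parallel_edges_near_le le_rfl).trans (two_mul_le_div hM
      (hα.matching (edge w l) (dirMatching l) (isDimensionalMatching_dirMatching l))).2
  · intro v i
    rw [Finset.card_map]
    exact half (two_mul_le_div hM (hβ.edge _)).2
  · intro v c
    simp only [memL]
    exact ncard_edges_at_le (half (two_mul_le_div hM (hβ.vertex v (σ c))).2)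
  · intro w l c
    simp only [memL]
    exact (ncard_parallel_edges_near_le le_rfl).trans (two_mul_le_div hM
      (hβ.matching (edge w l) (dirMatching l) (isDimensionalMatching_dirMatching l) (σ c))).2
  · intro v
    simp only [memL]
    exact hσ (Sum.inl v)
  · intro v l
    simp only [memL]
    exact hσ (Sum.inr (Sum.inl (v, l)))
  · intro v
    simp only [mapsome]
    exact hσ (Sum.inr (Sum.inr v))

/-- A proper coloring in terms of vertices and directions is a coloring of the line graph. -/
lemma IsProper.exists_lineGraph_coloring {f : (Fin d → Bool) → Fin d → Fin d} (hf : IsProper f) :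
    ∃ g : (hypercube d).lineGraph.Coloring (Fin d), ∀ v i, g (edge v i) = f v i := by
  choose base dir hbd using edge_surj (d := d)
  have key : ∀ v i, f (base (edge v i)) (dir (edge v i)) = f v i := by
    intro v i
    obtain ⟨h1, h2⟩ := edge_eq (hbd (edge v i))
    rw [← h1]
    rcases h2 with h2 | h2
    · rw [← h2]
    · rw [← h1] at h2
      rw [← hf.symm v i, fl_eq_iff.2 h2]
  refine ⟨SimpleGraph.Coloring.mk (fun e => f (base e) (dir e)) ?_, key⟩
  intro e e' hadj
  obtain ⟨hne, v, hv, hv'⟩ := SimpleGraph.lineGraph_adj_iff_exists.1 hadj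
  obtain ⟨i, rfl⟩ := exists_edge_of_mem hv
  obtain ⟨j, rfl⟩ := exists_edge_of_mem hv'
  rw [key, key]
  exact fun h => hne (by rw [hf.inj v h])

end

end

end HypercubeColoring

theorem theorem1 :
    ∃ α β : ℝ, 0 < α ∧ 0 < β ∧
      ∀ d : ℕ, 0 < d →
      ∀ (φ : (hypercube d).edgeSet → Option (Fin d))
        (L : (hypercube d).edgeSet → Finset (Fin d)),
        IsPrecoloring φ → IsDense α φ → IsSparse β L →
        (∀ (e : (hypercube d).edgeSet) (c : Fin d), φ e = some c → c ∉ L e) →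
        ∃ f : (hypercube d).lineGraph.Coloring (Fin d),
          (∀ (e : (hypercube d).edgeSet) (c : Fin d), φ e = some c → f e = c) ∧
          ∀ e : (hypercube d).edgeSet, f e ∉ L e := by
  -- `M` is kept abstract, so that `100 ^ M` is never evaluated
  obtain ⟨M, hM⟩ : ∃ M : ℕ, 10 ^ 15 < M := ⟨_, Nat.lt_succ_self _⟩
  have hM0 : 0 < M := by omega
  have hpos : (0 : ℝ) < 1 / 100 ^ M := by positivity
  refine ⟨1 / 100 ^ M, 1 / 100 ^ M, hpos, hpos, fun d hd φ L hφ hα hβ hL => ?_⟩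
  obtain ⟨σ, h⟩ := HypercubeColoring.exists_locallySparse hd hM0 hφ hα hβ hL
  have hdM : 10 ^ 15 * (d / M) < d := by
    rcases Nat.eq_zero_or_pos (d / M) with h0 | h0
    · rw [h0]; omega
    · exact lt_of_lt_of_le (Nat.mul_lt_mul_of_pos_right hM h0) (Nat.mul_div_le d M)
  obtain ⟨f, hf, hfp, hfL⟩ := h.exists_coloring hdM
  have hf' : HypercubeColoring.IsProper fun v i => σ (f v i) :=
    ⟨fun v i => by rw [hf.symm], fun v => σ.injective.comp (hf.inj v)⟩
  obtain ⟨g, hg⟩ := hf'.exists_lineGraph_coloring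
  refine ⟨g, fun e c hc => ?_, fun e => ?_⟩
  · obtain ⟨v, i, rfl⟩ := HypercubeColoring.edge_surj e
    rw [hg, hfp v i (σ.symm c) (by simp [hc]), σ.apply_symm_apply]
  · obtain ⟨v, i, rfl⟩ := HypercubeColoring.edge_surj e
    have := hfL v i
    rw [hg]
    simpa [Finset.mem_map_equiv] using this
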